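/- Let \[A=\frac{2}{\sqrt\pi}\Bigl(1+\sqrt{1+\tfrac{3\pi}{8}}\Bigr)=2.79368\ldots,\qquad \widehat{A_3}=2^{3/4}(4+2\sqrt2)=11.48399\ldots\] (the constants of the explicit van der Corput second and third derivative tests for zeta sums). Let $s=\sigma+it$ with $\sigma,t$ real, and put $\tau=\frac{t}{2\pi}$. If $\frac12<\sigma<1$ and $\tau\ge 20$, then \[\Bigl|\zeta(s)-\sum_{n\le \tau^{1/2}}\frac{1}{n^s}\Bigr|\le \frac{\widehat{A_3}\,2^{\sigma-\frac12}}{2^{\sigma-\frac12}-1}\,\tau^{\frac12(\frac56-\sigma)}+ \frac{2^{1+\sigma}A}{1-2^{-\sigma}}\,\tau^{\frac23(\frac34-\sigma)}+4A\Bigl(1+\frac{4\log\tau}{3\log2}\Bigr)\tau^{2(\frac34-\sigma)}+8\,\tau^{2(\frac12-\sigma)}.\] -/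

import Mathlib

noncomputable section

/-- The constant `A = (2/√π)(1 + √(1 + 3π/8)) = 2.79368…` of the explicit second derivative test
`|∑_{X<n≤X+Y} e(f(n))| ≤ A (Λ Y + 2) λ^{-1/2}` (for `0 < λ ≤ f'' ≤ Λ`), i.e. of the estimate
`S(τ^α, t) ≤ 2A(τ^{1/2} + 2τ^{α-1/2})` for zeta sums. -/
def vdcA : ℝ := 2 / √Real.pi * (1 + √(1 + 3 * Real.pi / 8))

/-- The constant `Â₃ = 2^{3/4}(4 + 2√2) = 11.48399…` of the explicit third derivative test
for zeta sums. -/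
def vdcA3hat : ℝ := (2 : ℝ) ^ (3 / 4 : ℝ) * (4 + 2 * √2)

end

noncomputable section

open Finset

/-! Write n^{-s} = n^{-σ} e(-τ log n). The terms with n > τ^{1/2} are cut at τ^{2/3} and τ². On a
dyadic block (X, 2X] the weight n^{-σ} comes out by partial summation at the cost of X^{-σ}, leaving
a pure exponential sum.

For τ^{1/2} ≤ X ≤ τ^{2/3} the third derivative test `norm_zetaSum_le_third` bounds a block by a
constant times X^{1/2-σ} τ^{1/6}. As σ > 1/2, these bounds decay geometrically and the block at X =
τ^{1/2} dominates. For τ^{2/3} ≤ X ≤ τ² the second derivative test `norm_zetaSum_le_second` gives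
X^{-σ} τ^{1/2}, again geometric, plus X^{1-σ} τ^{-1/2}, which is estimated at X = τ² in each block;
the number of blocks produces the logarithm. Beyond τ², `norm_riemannZeta_sub_sum_le` compares ζ(s)
with its partial sum through the trapezoidal rule.

The second derivative test comes from the Kuzmin–Landau inequality, applied wherever the phase
increment is not near an integer, with the trivial bound elsewhere. The third derivative test
applies the second to the differenced phases supplied by the Weyl–van der Corput inequality
`weyl_vdc`. All tests are stated with finite differences of the phase, which are explicit for the
logarithm, so no derivatives of the phase are needed. -/

/-! ### The Kuzmin–Landau inequality. -/

/-- The additive character `e(x) = exp(2πix)`. -/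
def expCircle (x : ℝ) : ℂ := Complex.exp ((2 * Real.pi * x : ℝ) * Complex.I)

lemma expCircle_add (x y : ℝ) : expCircle (x + y) = expCircle x * expCircle y := by
  simp only [expCircle, ← Complex.exp_add]
  congr 1
  push_cast
  ring

lemma norm_expCircle (x : ℝ) : ‖expCircle x‖ = 1 := Complex.norm_exp_ofReal_mul_I _

lemma conj_expCircle (x : ℝ) : (starRingEnd ℂ) (expCircle x) = expCircle (-x) := by
  rw [expCircle, expCircle, ← Complex.exp_conj, map_mul, Complex.conj_ofReal, Complex.conj_I]
  congr 1
  push_cast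
  ring

lemma expCircle_int (k : ℤ) : expCircle k = 1 := by
  rw [expCircle, Complex.exp_eq_one_iff]
  exact ⟨k, by push_cast; ring⟩

lemma expCircle_eq (x : ℝ) : expCircle x =
    ((Real.cos (Real.pi * x) ^ 2 - Real.sin (Real.pi * x) ^ 2 : ℝ) : ℂ) +
      ((2 * Real.sin (Real.pi * x) * Real.cos (Real.pi * x) : ℝ) : ℂ) * Complex.I := by
  rw [expCircle, show 2 * Real.pi * x = 2 * (Real.pi * x) by ring, Complex.exp_mul_I,
    ← Complex.ofReal_cos, ← Complex.ofReal_sin, Real.cos_two_mul', Real.sin_two_mul]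

/-- The value `1 / (1 - e(x)) = (1 + i cot(πx)) / 2`. -/
def klCoeff (x : ℝ) : ℂ := (1 + (Real.cot (Real.pi * x) : ℂ) * Complex.I) / 2

lemma klCoeff_mul {x : ℝ} (h : Real.sin (Real.pi * x) ≠ 0) :
    klCoeff x * (1 - expCircle x) = 1 := by
  have h1 : (Real.sin (Real.pi * x) : ℂ) ^ 2 + (Real.cos (Real.pi * x) : ℂ) ^ 2 = 1 := by
    exact_mod_cast Real.sin_sq_add_cos_sq (Real.pi * x)
  have h2 : (Real.sin (Real.pi * x) : ℂ) ≠ 0 := by exact_mod_cast h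
  rw [klCoeff, expCircle_eq, Real.cot_eq_cos_div_sin]
  simp only [Complex.ofReal_div, Complex.ofReal_mul, Complex.ofReal_sub, Complex.ofReal_pow]
  generalize (Real.sin (Real.pi * x) : ℂ) = S at *
  generalize (Real.cos (Real.pi * x) : ℂ) = D at *
  rw [show 1 - (D ^ 2 - S ^ 2 + Complex.ofReal 2 * S * D * Complex.I) = 2 * S * (S - D * Complex.I) by
    rw [← h1]; push_cast; ring]
  field_simp
  linear_combination h1 - D ^ 2 * Complex.I_sq

lemma norm_klCoeff {x : ℝ} (h : 0 < Real.sin (Real.pi * x)) :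
    ‖klCoeff x‖ = 1 / (2 * Real.sin (Real.pi * x)) := by
  have h1 := Real.sin_sq_add_cos_sq (Real.pi * x)
  rw [klCoeff, norm_div, Real.cot_eq_cos_div_sin, Complex.norm_def, Complex.normSq_apply]
  set S := Real.sin (Real.pi * x)
  set D := Real.cos (Real.pi * x)
  have : Real.sqrt (1 + (D / S) * (D / S)) = 1 / S := by
    rw [show 1 + (D / S) * (D / S) = (1 / S) ^ 2 by field_simp; linarith]
    exact Real.sqrt_sq (by positivity)
  simp at this ⊢
  rw [this]; ring

lemma norm_klCoeff_sub (x y : ℝ) : ‖klCoeff x - klCoeff y‖ =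
    |Real.cot (Real.pi * x) - Real.cot (Real.pi * y)| / 2 := by
  have : klCoeff x - klCoeff y =
      ((Real.cot (Real.pi * x) - Real.cot (Real.pi * y) : ℝ) : ℂ) * Complex.I / 2 := by
    rw [klCoeff, klCoeff]; push_cast; ring
  rw [this, norm_div, norm_mul, Complex.norm_real]
  simp

lemma cot_le_cot {a b : ℝ} (ha : 0 < a) (hab : a ≤ b) (hb : b < Real.pi) :
    Real.cot b ≤ Real.cot a := by
  have hsa := Real.sin_pos_of_pos_of_lt_pi ha (by linarith)
  have hsb := Real.sin_pos_of_pos_of_lt_pi (ha.trans_le hab) hb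
  have := Real.sin_nonneg_of_nonneg_of_le_pi (sub_nonneg.2 hab) (by linarith)
  rw [Real.sin_sub] at this
  rw [Real.cot_eq_cos_div_sin, Real.cot_eq_cos_div_sin, div_le_div_iff₀ hsb hsa]
  linarith

/-- The left side is cot(a/2), so this is tan b > b at b = a/2. In `kuzminLandau` it absorbs an
endpoint term of the Abel summation together with the cotangent left over from telescoping. -/
lemma one_div_sin_add_cot_le {a : ℝ} (ha : 0 < a) (ha' : a < Real.pi) :
    1 / Real.sin a + Real.cot a ≤ 2 / a := by
  obtain ⟨b, rfl⟩ : ∃ b, a = 2 * b := ⟨a / 2, by ring⟩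
  have hb : 0 < b := by linarith
  have hc : 0 < Real.cos b := Real.cos_pos_of_mem_Ioo ⟨by linarith, by linarith⟩
  have hs : 0 < Real.sin b := Real.sin_pos_of_pos_of_lt_pi hb (by linarith)
  have ht := Real.lt_tan hb (by linarith)
  rw [Real.tan_eq_sin_div_cos, lt_div_iff₀ hc] at ht
  have h1 := Real.sin_sq_add_cos_sq b
  rw [Real.cot_eq_cos_div_sin, Real.sin_two_mul, Real.cos_two_mul, ← add_div,
    div_le_div_iff₀ (by positivity) (by positivity)]
  nlinarith [mul_pos hc hb]

lemma one_div_sin_sub_cot_le {a : ℝ} (ha : 0 < a) (ha' : a < Real.pi) :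
    1 / Real.sin a - Real.cot a ≤ 2 / (Real.pi - a) := by
  have := one_div_sin_add_cot_le (sub_pos.2 ha') (by linarith : Real.pi - a < Real.pi)
  rw [Real.cot_eq_cos_div_sin, Real.sin_pi_sub, Real.cos_pi_sub] at this
  rw [Real.cot_eq_cos_div_sin]
  rw [neg_div] at this
  linarith

/-- Each e(g n) equals the coefficient 1/(1 - e(Δ)), with Δ the increment at n, times e(g n) - e(g
(n+1)). After Abel summation the interior terms carry differences of these coefficients, whose norms
are half the cotangent differences. Monotone increments give those a constant sign, so they
telescope. -/
lemma kuzminLandau_aux (g : ℕ → ℝ) (N : ℕ)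
    (hpos : ∀ n ≤ N, 0 < g (n + 1) - g n) (hlt : ∀ n ≤ N, g (n + 1) - g n < 1)
    (hmono : ∀ n < N, g (n + 1) - g n ≤ g (n + 2) - g (n + 1)) :
    ‖∑ n ∈ range (N + 1), expCircle (g n) - (klCoeff (g 1 - g 0) * expCircle (g 0)
        - klCoeff (g (N + 1) - g N) * expCircle (g (N + 1)))‖ ≤
      (Real.cot (Real.pi * (g 1 - g 0)) - Real.cot (Real.pi * (g (N + 1) - g N))) / 2 := by
  have key : ∀ n ≤ N, expCircle (g n) =
      klCoeff (g (n + 1) - g n) * (expCircle (g n) - expCircle (g (n + 1))) := by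
    intro n hn
    have hs : Real.sin (Real.pi * (g (n + 1) - g n)) ≠ 0 :=
      (Real.sin_pos_of_pos_of_lt_pi (mul_pos Real.pi_pos (hpos n hn))
        (by nlinarith [hlt n hn, Real.pi_pos])).ne'
    have h1 := klCoeff_mul hs
    have h2 : expCircle (g (n + 1)) = expCircle (g n) * expCircle (g (n + 1) - g n) := by
      rw [← expCircle_add]; congr 1; ring
    rw [h2]
    linear_combination (-expCircle (g n)) * h1
  induction N with
  | zero =>
    have := key 0 le_rfl
    simp only [zero_add, sum_range_one, sub_self, zero_div] at this ⊢
    rw [norm_le_zero_iff]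
    linear_combination this
  | succ N ih =>
    have ih' := ih (fun n hn => hpos n (by omega)) (fun n hn => hlt n (by omega))
      (fun n hn => hmono n (by omega)) (fun n hn => key n (by omega))
    have hk := key (N + 1) le_rfl
    rw [sum_range_succ]
    have e1 : ∑ n ∈ range (N + 1), expCircle (g n) + expCircle (g (N + 1)) -
        (klCoeff (g 1 - g 0) * expCircle (g 0) -
          klCoeff (g (N + 1 + 1) - g (N + 1)) * expCircle (g (N + 1 + 1))) =
        (∑ n ∈ range (N + 1), expCircle (g n) - (klCoeff (g 1 - g 0) * expCircle (g 0)
          - klCoeff (g (N + 1) - g N) * expCircle (g (N + 1)))) +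
        (klCoeff (g (N + 1 + 1) - g (N + 1)) - klCoeff (g (N + 1) - g N)) *
          expCircle (g (N + 1)) := by
      linear_combination hk
    rw [e1]
    refine (norm_add_le _ _).trans ?_
    rw [norm_mul, norm_expCircle, mul_one, norm_klCoeff_sub]
    have hc : Real.cot (Real.pi * (g (N + 1 + 1) - g (N + 1))) ≤
        Real.cot (Real.pi * (g (N + 1) - g N)) := by
      apply cot_le_cot
      · exact mul_pos Real.pi_pos (hpos N (by omega))
      · exact mul_le_mul_of_nonneg_left (hmono N (by omega)) Real.pi_pos.le
      · nlinarith [hlt (N + 1) le_rfl, Real.pi_pos]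
    rw [abs_of_nonpos (sub_nonpos.2 hc)]
    linarith

/-- The Kuzmin–Landau inequality. -/
lemma kuzminLandau (g : ℕ → ℝ) (N : ℕ) (k : ℤ) {θ : ℝ} (hθ : 0 < θ)
    (hlow : ∀ n < N, k + θ ≤ g (n + 1) - g n) (hup : ∀ n < N, g (n + 1) - g n ≤ k + 1 - θ)
    (hmono : ∀ n, n + 1 < N → g (n + 1) - g n ≤ g (n + 2) - g (n + 1)) :
    ‖∑ n ∈ range N, expCircle (g n)‖ ≤ 2 / (Real.pi * θ) := by
  have hpi := Real.pi_pos
  rcases N with _ | N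
  · simp; positivity
  -- Subtracting k n changes no value of e and moves the increments into [θ, 1 - θ].
  set f : ℕ → ℝ := fun n => g n - k * n with hf
  have hfd : ∀ n, f (n + 1) - f n = g (n + 1) - g n - k := by
    intro n; simp only [hf]; push_cast; ring
  have hfe : ∀ n, expCircle (f n) = expCircle (g n) := by
    intro n
    have : g n = f n + ((k * n : ℤ) : ℝ) := by simp [hf]
    rw [this, expCircle_add, expCircle_int, mul_one]
  have hl : ∀ n ≤ N, θ ≤ f (n + 1) - f n := fun n hn => by
    rw [hfd]; linarith [hlow n (by omega)]
  have hu : ∀ n ≤ N, f (n + 1) - f n ≤ 1 - θ := fun n hn => by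
    rw [hfd]; linarith [hup n (by omega)]
  have hm := kuzminLandau_aux f N (fun n hn => hθ.trans_le (hl n hn))
    (fun n hn => by linarith [hu n hn])
    (fun n hn => by
      have := hfd (n + 1)
      rw [show n + 1 + 1 = n + 2 by ring] at this
      rw [this, hfd]; linarith [hmono n (by omega)])
  simp only [hfe] at hm
  have bd : ∀ n ≤ N, 0 < Real.sin (Real.pi * (f (n + 1) - f n)) := fun n hn =>
    Real.sin_pos_of_pos_of_lt_pi (mul_pos hpi (hθ.trans_le (hl n hn)))
        (by nlinarith [hu n hn])
  have n1 : ‖klCoeff (f 1 - f 0) * expCircle (g 0)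
        - klCoeff (f (N + 1) - f N) * expCircle (g (N + 1))‖ ≤
      1 / (2 * Real.sin (Real.pi * (f 1 - f 0))) +
        1 / (2 * Real.sin (Real.pi * (f (N + 1) - f N))) := by
    refine (norm_sub_le _ _).trans ?_
    rw [norm_mul, norm_mul, norm_expCircle, norm_expCircle, mul_one, mul_one,
      norm_klCoeff (bd 0 (by omega)), norm_klCoeff (bd N le_rfl)]
  have n2 := norm_le_norm_sub_add (∑ n ∈ range (N + 1), expCircle (g n))
    (klCoeff (f 1 - f 0) * expCircle (g 0) - klCoeff (f (N + 1) - f N) * expCircle (g (N + 1)))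
  have a1 : 1 / Real.sin (Real.pi * (f 1 - f 0)) + Real.cot (Real.pi * (f 1 - f 0))
      ≤ 2 / (Real.pi * θ) := by
    refine (one_div_sin_add_cot_le (mul_pos hpi (hθ.trans_le (hl 0 (by omega))))
      (by nlinarith [hu 0 (by omega)])).trans ?_
    gcongr
    exact hl 0 (by omega)
  have a2 : 1 / Real.sin (Real.pi * (f (N + 1) - f N)) - Real.cot (Real.pi * (f (N + 1) - f N))
      ≤ 2 / (Real.pi * θ) := by
    refine (one_div_sin_sub_cot_le (mul_pos hpi (hθ.trans_le (hl N (by omega))))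
      (by nlinarith [hu N (by omega)])).trans ?_
    gcongr
    nlinarith [hu N le_rfl]
  have e : ∀ x : ℝ, 1 / (2 * x) = (1 / x) / 2 := fun x => by rw [one_div, mul_inv]; ring
  rw [e, e] at n1
  linarith

/-! ### The second derivative test for sequences. -/

lemma exists_eq_Ico_of_ordConnected (S : Finset ℕ)
    (h : ∀ a ∈ S, ∀ c ∈ S, ∀ b, a ≤ b → b ≤ c → b ∈ S) : ∃ p q, p ≤ q ∧ S = Ico p q := by
  rcases S.eq_empty_or_nonempty with rfl | hS
  · exact ⟨0, 0, le_rfl, by simp⟩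
  · refine ⟨S.min' hS, S.max' hS + 1, (S.min'_le_max' hS).trans (Nat.le_succ _), ?_⟩
    ext b
    rw [mem_Ico]
    exact ⟨fun hb => ⟨S.min'_le b hb, Nat.lt_succ_of_le (S.le_max' b hb)⟩,
      fun hb => h _ (S.min'_mem hS) _ (S.max'_mem hS) b hb.1 (Nat.le_of_lt_succ hb.2)⟩

lemma add_mul_le_of_step {d : ℕ → ℝ} {N : ℕ} {l : ℝ}
    (h : ∀ n, n + 1 < N → d n + l ≤ d (n + 1)) {n m : ℕ} (hnm : n ≤ m) (hm : m < N) :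
    d n + l * (m - n) ≤ d m := by
  induction m, hnm using Nat.le_induction with
  | base => simp
  | succ m hnm ih =>
    have := ih (by omega)
    have := h m hm
    push_cast
    linarith

lemma norm_sum_expCircle_Ico_le (g : ℕ → ℝ) (p q : ℕ) :
    ‖∑ n ∈ Ico p q, expCircle (g n)‖ ≤ ((q - p : ℕ) : ℝ) := by
  refine (norm_sum_le _ _).trans ?_
  simp [norm_expCircle]

/-- The terms whose phase increment lies in a window of length one around the integer `k`. -/
lemma norm_sum_window_le (g : ℕ → ℝ) (N : ℕ) {l θ : ℝ} (hl : 0 < l) (hθ : 0 < θ)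
    (h : ∀ n, n + 1 < N → g (n + 1) - g n + l ≤ g (n + 2) - g (n + 1)) (k : ℤ) :
    ‖∑ n ∈ range N with ⌊g (n + 1) - g n + θ⌋ = k, expCircle (g n)‖ ≤
      2 * θ / l + 1 + 2 / (Real.pi * θ) := by
  set d : ℕ → ℝ := fun n => g (n + 1) - g n with hd
  have hstep : ∀ {n m : ℕ}, n ≤ m → m < N → d n + l * (m - n) ≤ d m :=
    fun hnm hm => add_mul_le_of_step (d := d) h hnm hm
  have hmono : ∀ {n m : ℕ}, n ≤ m → m < N → d n ≤ d m := fun {n m} hnm hm => by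
    have := hstep hnm hm
    have h2 : (n : ℝ) ≤ m := by exact_mod_cast hnm
    nlinarith
  -- Increments within θ of k are few, since they grow by at least l per step, and are counted
  -- trivially. The others lie in [k + θ, k + 1 - θ], where Kuzmin–Landau applies. Monotonicity
  -- makes both index sets intervals.
  rw [← sum_filter_add_sum_filter_not _ (fun n => d n < k + θ)]
  refine (norm_add_le _ _).trans (add_le_add ?_ ?_)
  · obtain ⟨p, q, hpq, hS⟩ := exists_eq_Ico_of_ordConnected
      (((range N).filter (fun n => ⌊d n + θ⌋ = k)).filter (fun n => d n < k + θ)) (by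
        intro a ha c hc b hab hbc
        simp only [mem_filter, mem_range, Int.floor_eq_iff] at ha hc ⊢
        have := hmono hab (by omega)
        have := hmono hbc (by omega)
        exact ⟨⟨by omega, by linarith, by linarith⟩, by linarith⟩)
    rw [hS]
    refine (norm_sum_expCircle_Ico_le _ _ _).trans ?_
    rcases hpq.eq_or_lt with rfl | hlt
    · simp; positivity
    · have hp : p ∈ Ico p q := by simp [hlt]
      have hq : q - 1 ∈ Ico p q := by simp; omega
      rw [← hS] at hp hq
      simp only [mem_filter, mem_range, Int.floor_eq_iff] at hp hq
      have := hstep (show p ≤ q - 1 by omega) hq.1.1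
      have e : ((q - p : ℕ) : ℝ) = ((q - 1 : ℕ) : ℝ) - p + 1 := by
        rw [Nat.cast_sub hlt.le, Nat.cast_sub (by omega)]; push_cast; ring
      rw [e]
      gcongr
      rw [le_div_iff₀ hl]
      nlinarith
  · obtain ⟨p, q, hpq, hS⟩ := exists_eq_Ico_of_ordConnected
      (((range N).filter (fun n => ⌊d n + θ⌋ = k)).filter (fun n => ¬ d n < k + θ)) (by
        intro a ha c hc b hab hbc
        simp only [mem_filter, mem_range, Int.floor_eq_iff, not_lt] at ha hc ⊢
        have := hmono hab (by omega)
        have := hmono hbc (by omega)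
        exact ⟨⟨by omega, by linarith, by linarith⟩, by linarith⟩)
    rw [hS, sum_Ico_eq_sum_range]
    have hmem : ∀ n, n < q - p → p + n < N ∧ k + θ ≤ d (p + n) ∧ d (p + n) ≤ k + 1 - θ := by
      intro n hn
      have hp : p + n ∈ Ico p q := by simp; omega
      rw [← hS] at hp
      simp only [mem_filter, mem_range, Int.floor_eq_iff, not_lt] at hp
      exact ⟨hp.1.1, hp.2, by linarith [hp.1.2.2]⟩
    refine kuzminLandau (fun n => g (p + n)) (q - p) k hθ (fun n hn => (hmem n hn).2.1)
      (fun n hn => (hmem n hn).2.2) (fun n hn => ?_)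
    exact hmono (Nat.le_succ (p + n)) (hmem (n + 1) hn).1

lemma card_Icc_floor_le {x y V : ℝ} (hxy : x ≤ y) (h : y - x ≤ V) :
    ((Icc ⌊x⌋ ⌊y⌋).card : ℝ) ≤ V + 2 := by
  have h1 := Int.floor_le_floor hxy
  have h2 : (((Icc ⌊x⌋ ⌊y⌋).card : ℤ) : ℝ) ≤ V + 2 := by
    rw [Int.card_Icc, Int.toNat_of_nonneg (by omega)]
    push_cast
    linarith [Int.floor_le y, Int.lt_floor_add_one x]
  exact_mod_cast h2

/-- One window costs (4/√π + √l)/√l, and √l ≤ 1/2 because l ≤ 1/4. -/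
lemma four_div_sqrt_pi_add_half_le_vdcA : 4 / √Real.pi + 1 / 2 ≤ vdcA := by
  have hpi := Real.pi_pos
  have hs : 0 < √Real.pi := Real.sqrt_pos.2 hpi
  have hsq : √Real.pi ^ 2 = Real.pi := Real.sq_sqrt hpi.le
  have h3 : (1.7 : ℝ) ≤ √Real.pi := by
    apply Real.le_sqrt_of_sq_le; linarith [Real.pi_gt_three]
  have : 1 + √Real.pi / 4 ≤ √(1 + 3 * Real.pi / 8) := by
    apply Real.le_sqrt_of_sq_le
    nlinarith [Real.pi_gt_three, Real.pi_lt_four]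
  rw [vdcA, show 4 / √Real.pi + 1 / 2 = 2 / √Real.pi * (1 + (1 + √Real.pi / 4)) by
    field_simp; ring]
  gcongr

/-- The second derivative test, for a sequence with second differences at least `l`. -/
lemma norm_sum_expCircle_le_of_second_difference (g : ℕ → ℝ) (N : ℕ) {l V : ℝ} (hl : 0 < l)
    (hl' : l ≤ 1 / 4) (h : ∀ n, n + 1 < N → g (n + 1) - g n + l ≤ g (n + 2) - g (n + 1))
    (hV : ∀ n < N, ∀ m < N, (g (m + 1) - g m) - (g (n + 1) - g n) ≤ V) (hV0 : 0 ≤ V) :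
    ‖∑ n ∈ range N, expCircle (g n)‖ ≤ vdcA * (V + 2) / √l := by
  have hpi := Real.pi_pos
  have hA := four_div_sqrt_pi_add_half_le_vdcA
  have hA0 : 0 ≤ vdcA := le_trans (by positivity) hA
  have hsl : 0 < √l := Real.sqrt_pos.2 hl
  have hsl' : √l ≤ 1 / 2 := by
    rw [Real.sqrt_le_left (by norm_num)]; norm_num; linarith
  rcases N with _ | N
  · simp; positivity
  have hmono : ∀ n ≤ N, ∀ m ≤ N, n ≤ m → g (n + 1) - g n ≤ g (m + 1) - g m := by
    intro n hn m hm hnm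
    have := add_mul_le_of_step (d := fun n => g (n + 1) - g n) h hnm (by omega)
    have h2 : (n : ℝ) ≤ m := by exact_mod_cast hnm
    have h3 : 0 ≤ l * ((m : ℝ) - n) := mul_nonneg hl.le (by linarith)
    linarith
  -- This θ minimises 2θ/l + 2/(πθ), the minimum being 4/√(πl).
  set θ := √l / √Real.pi with hθ
  have hspi : 0 < √Real.pi := Real.sqrt_pos.2 hpi
  have hθ0 : 0 < θ := by positivity
  rw [← sum_fiberwise_of_maps_to (s := range (N + 1))
    (t := Icc ⌊g (0 + 1) - g 0 + θ⌋ ⌊g (N + 1) - g N + θ⌋)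
    (g := fun n => ⌊g (n + 1) - g n + θ⌋) (by
      intro n hn
      rw [mem_range] at hn
      rw [mem_Icc]
      exact ⟨Int.floor_le_floor (by linarith [hmono 0 (by omega) n (by omega) (by omega)]),
        Int.floor_le_floor (by linarith [hmono n (by omega) N le_rfl (by omega)])⟩)]
  refine (norm_sum_le _ _).trans ?_
  refine (sum_le_card_nsmul _ _ _ fun k _ => norm_sum_window_le g (N + 1) hl hθ0 h k).trans ?_
  rw [nsmul_eq_mul, show vdcA * (V + 2) / √l = (V + 2) * (vdcA / √l) by ring]
  refine mul_le_mul (card_Icc_floor_le (by linarith [hmono 0 (by omega) N le_rfl (by omega)])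
    (by linarith [hV 0 (by omega) N (by omega)])) ?_ (by positivity) (by linarith)
  rw [le_div_iff₀ hsl]
  have e1 : √l ^ 2 = l := Real.sq_sqrt hl.le
  have e2 : √Real.pi ^ 2 = Real.pi := Real.sq_sqrt hpi.le
  have : (2 * θ / l + 1 + 2 / (Real.pi * θ)) * √l = 4 / √Real.pi + √l := by
    have : ∀ x y : ℝ, 0 < x → 0 < y →
        (2 * (x / y) / x ^ 2 + 1 + 2 / (y ^ 2 * (x / y))) * x = 4 / y + x := by
      intro x y hx hy
      field_simp
      ring
    have := this _ _ hsl hspi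
    rwa [e1, e2] at this
  rw [this]
  linarith

/-! ### Partial summation and the Weyl–van der Corput inequality. -/

/-- Partial summation against a nonnegative antitone weight. -/
lemma norm_sum_mul_le_of_antitone (w : ℕ → ℝ) (z : ℕ → ℂ) (N : ℕ) {B : ℝ} (hw : Antitone w)
    (hw0 : ∀ n, 0 ≤ w n) (hB : ∀ M ≤ N, ‖∑ n ∈ range M, z n‖ ≤ B) :
    ‖∑ n ∈ range N, (w n : ℂ) * z n‖ ≤ w 0 * B := by
  have key : ‖∑ n ∈ range N, (w n : ℂ) * z n - w N * ∑ n ∈ range N, z n‖ ≤ (w 0 - w N) * B := by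
    induction N with
    | zero => simp
    | succ N ih =>
      have h1 := ih (fun M hM => hB M (by omega))
      have h2 := hB (N + 1) le_rfl
      have h3 := hw (Nat.le_succ N)
      rw [sum_range_succ (fun n => (w n : ℂ) * z n)]
      have e : ∑ n ∈ range N, (w n : ℂ) * z n + w N * z N - w (N + 1) * ∑ n ∈ range (N + 1), z n =
          (∑ n ∈ range N, (w n : ℂ) * z n - w N * ∑ n ∈ range N, z n) +
            ((w N - w (N + 1) : ℝ) : ℂ) * ∑ n ∈ range (N + 1), z n := by
        rw [sum_range_succ z]; push_cast; ring
      rw [e]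
      refine (norm_add_le _ _).trans ?_
      rw [norm_mul, Complex.norm_real, Real.norm_of_nonneg (sub_nonneg.2 h3)]
      nlinarith [mul_le_mul_of_nonneg_left h2 (sub_nonneg.2 h3)]
  have h2 := hB N le_rfl
  have h4 := norm_le_norm_sub_add (∑ n ∈ range N, (w n : ℂ) * z n) (w N * ∑ n ∈ range N, z n)
  rw [norm_mul, Complex.norm_real, Real.norm_of_nonneg (hw0 N)] at h4
  nlinarith [mul_le_mul_of_nonneg_left h2 (hw0 N)]

open scoped ComplexConjugate in
/-- The Weyl–van der Corput inequality for a finitely supported sequence on `ℤ`. -/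
lemma weyl_vdc_int (z : ℤ → ℂ) (N H : ℕ) (hH : 0 < H)
    (hz : ∀ m : ℤ, ¬ (0 ≤ m ∧ m < N) → z m = 0) :
    (H : ℝ) ^ 2 * ‖∑ m ∈ Ico (0 : ℤ) N, z m‖ ^ 2 ≤
      (N + H) * ∑ i ∈ range H, ∑ j ∈ range H,
        ‖∑ m ∈ Ico (-(H : ℤ)) N, z (m + i) * conj (z (m + j))‖ := by
  have hshift : ∀ i ∈ range H, ∑ m ∈ Ico (-(H : ℤ)) N, z (m + i) = ∑ m ∈ Ico (0 : ℤ) N, z m := by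
    intro i hi
    rw [mem_range] at hi
    rw [← sum_image (s := Ico (-(H : ℤ)) N) (g := fun m => m + (i : ℤ)) (f := z)
      (fun a _ b _ hab => by simpa using hab), image_add_right_Ico]
    symm
    refine sum_subset (fun m hm => ?_) (fun m _ hm => hz m ?_)
    · rw [mem_Ico] at hm ⊢; omega
    · rw [mem_Ico] at hm; omega
  -- Averaging over H shifts: Cauchy–Schwarz over the N + H values of m, then expansion of the
  -- square, leaves the correlations of z.
  have h1 : (H : ℂ) * ∑ m ∈ Ico (0 : ℤ) N, z m =
      ∑ m ∈ Ico (-(H : ℤ)) N, ∑ i ∈ range H, z (m + i) := by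
    rw [sum_comm, sum_congr rfl hshift]; simp
  have h2 : (H : ℝ) * ‖∑ m ∈ Ico (0 : ℤ) N, z m‖ ≤
      ∑ m ∈ Ico (-(H : ℤ)) N, ‖∑ i ∈ range H, z (m + i)‖ := by
    have := norm_sum_le (Ico (-(H : ℤ)) N) (fun m => ∑ i ∈ range H, z (m + i))
    rw [← h1, norm_mul, Complex.norm_natCast] at this
    exact this
  have h3 : (∑ m ∈ Ico (-(H : ℤ)) N, ‖∑ i ∈ range H, z (m + i)‖) ^ 2 ≤
      (N + H) * ∑ m ∈ Ico (-(H : ℤ)) N, ‖∑ i ∈ range H, z (m + i)‖ ^ 2 := by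
    refine sq_sum_le_card_mul_sum_sq.trans_eq ?_
    rw [Int.card_Ico]
    congr 1
    rw [show (N : ℤ) - -(H : ℤ) = ((N + H : ℕ) : ℤ) by push_cast; ring,
      Int.toNat_natCast]
    push_cast
    rfl
  rw [← mul_pow]
  refine (pow_le_pow_left₀ (by positivity) h2 2).trans (h3.trans ?_)
  gcongr
  have h4 : ((∑ m ∈ Ico (-(H : ℤ)) N, ‖∑ i ∈ range H, z (m + i)‖ ^ 2 : ℝ) : ℂ) =
      ∑ i ∈ range H, ∑ j ∈ range H, ∑ m ∈ Ico (-(H : ℤ)) N, z (m + i) * conj (z (m + j)) := by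
    push_cast
    simp_rw [← Complex.mul_conj', map_sum, sum_mul_sum]
    rw [sum_comm]
    refine sum_congr rfl fun i _ => sum_comm
  calc _ = ‖((∑ m ∈ Ico (-(H : ℤ)) N, ‖∑ i ∈ range H, z (m + i)‖ ^ 2 : ℝ) : ℂ)‖ := by
        rw [Complex.norm_real, Real.norm_of_nonneg (by positivity)]
    _ ≤ _ := by
        rw [h4]
        exact (norm_sum_le _ _).trans (sum_le_sum fun i _ => norm_sum_le _ _)

/-- From a fixed i, the distance 0 occurs once and every other distance at most twice. -/
lemma sum_range_dist_le (R : ℕ → ℝ) (hR : ∀ d, 0 ≤ R d) {i H : ℕ} (hi : i < H) :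
    ∑ j ∈ range H, (if j ≤ i then R (i - j) else R (j - i)) ≤ R 0 + 2 * ∑ d ∈ Ico 1 H, R d := by
  rw [sum_ite]
  have h1 : ∑ j ∈ range H with j ≤ i, R (i - j) ≤ ∑ d ∈ range H, R d := by
    rw [← sum_image (g := fun j => i - j) (f := R) (fun a ha b hb hab => by
      simp at ha hb hab; omega)]
    refine sum_le_sum_of_subset_of_nonneg (fun d hd => ?_) fun d _ _ => hR d
    simp only [mem_image, mem_filter, mem_range] at hd ⊢
    omega
  have h2 : ∑ j ∈ range H with ¬ j ≤ i, R (j - i) ≤ ∑ d ∈ Ico 1 H, R d := by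
    rw [← sum_image (g := fun j => j - i) (f := R) (fun a ha b hb hab => by
      simp at ha hb hab; omega)]
    refine sum_le_sum_of_subset_of_nonneg (fun d hd => ?_) fun d _ _ => hR d
    simp only [mem_image, mem_filter, mem_range, mem_Ico] at hd ⊢
    omega
  have h3 : ∑ d ∈ range H, R d = R 0 + ∑ d ∈ Ico 1 H, R d := by
    rw [range_eq_Ico, sum_eq_sum_Ico_succ_bot (by omega)]
  linarith

open scoped ComplexConjugate in
/-- The Weyl–van der Corput inequality for exponential sums. -/
lemma weyl_vdc (f : ℕ → ℝ) (N H : ℕ) (hH : 0 < H) :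
    (H : ℝ) * ‖∑ n ∈ range N, expCircle (f n)‖ ^ 2 ≤
      (N + H) * (N + 2 * ∑ d ∈ Ico 1 H,
        ‖∑ n ∈ range (N - d), expCircle (f (n + d) - f n)‖) := by
  set R : ℕ → ℝ := fun d => ‖∑ n ∈ range (N - d), expCircle (f (n + d) - f n)‖ with hR
  set z : ℤ → ℂ := fun m => if 0 ≤ m ∧ m < N then expCircle (f m.toNat) else 0 with hz
  -- The range of m is long enough to contain every nonzero product, so a correlation depends only
  -- on the difference of the shifts.
  have hcorr : ∀ i d : ℕ, i < H →
      ‖∑ m ∈ Ico (-(H : ℤ)) N, z (m + (i + d : ℕ)) * conj (z (m + i))‖ = R d := by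
    intro i d hi
    have e : ∑ n ∈ range (N - d), expCircle (f (n + d) - f n) =
        ∑ m ∈ Ico (-(H : ℤ)) N, z (m + (i + d : ℕ)) * conj (z (m + i)) := by
      refine sum_of_injOn (fun n : ℕ => (n : ℤ) - i) (fun a _ b _ hab => by simpa using hab)
        (fun n hn => ?_) (fun m hm hm' => ?_) (fun n hn => ?_)
      · simp at hn ⊢; omega
      · by_cases hc : 0 ≤ m + i ∧ m + ((i + d : ℕ) : ℤ) < N
        · exfalso
          apply hm'
          refine ⟨(m + i).toNat, ?_, ?_⟩
          · simp; push_cast at hc; omega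
          · simp [hc.1]
        · rw [not_and_or] at hc
          rcases hc with hc | hc
          · simp [hz, hc]
          · have : z (m + (i + d : ℕ)) = 0 := if_neg fun h => hc h.2
            rw [this, zero_mul]
      · rw [mem_range] at hn
        have e1 : (n : ℤ) - i + ((i + d : ℕ) : ℤ) = ((n + d : ℕ) : ℤ) := by push_cast; ring
        have e2 : (n : ℤ) - i + (i : ℤ) = (n : ℤ) := by ring
        have e3 : z ((n + d : ℕ) : ℤ) = expCircle (f (n + d)) := by
          rw [hz]
          simp only
          rw [if_pos ⟨by omega, by omega⟩, Int.toNat_natCast]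
        have e4 : z (n : ℤ) = expCircle (f n) := by
          rw [hz]
          simp only
          rw [if_pos ⟨by omega, by omega⟩, Int.toNat_natCast]
        rw [e1, e2, e3, e4, conj_expCircle, ← expCircle_add, sub_eq_add_neg]
    rw [← e]
  have hsum : ∑ m ∈ Ico (0 : ℤ) N, z m = ∑ n ∈ range N, expCircle (f n) := by
    symm
    refine sum_of_injOn (fun n : ℕ => (n : ℤ)) (fun a _ b _ hab => by simpa using hab)
      (fun n hn => by simpa using hn) (fun m hm hm' => ?_) (fun n hn => ?_)
    · exfalso
      rw [mem_Ico] at hm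
      exact hm' ⟨m.toNat, by simp; omega, by simp [hm.1]⟩
    · rw [mem_range] at hn
      simp [hz, hn]
  have main := weyl_vdc_int z N H hH (fun m hm => if_neg hm)
  have hb : ∑ i ∈ range H, ∑ j ∈ range H,
      ‖∑ m ∈ Ico (-(H : ℤ)) N, z (m + i) * conj (z (m + j))‖ ≤
      H * (N + 2 * ∑ d ∈ Ico 1 H, R d) := by
    have h0 : R 0 = N := by
      simp [hR, expCircle]
    rw [← h0]
    refine (sum_le_card_nsmul _ _ _ fun i hi => ?_).trans_eq (by rw [card_range, nsmul_eq_mul])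
    rw [mem_range] at hi
    refine le_of_eq_of_le (sum_congr rfl fun j hj => ?_)
      (sum_range_dist_le R (fun d => norm_nonneg _) hi)
    rw [mem_range] at hj
    split_ifs with hij
    · obtain ⟨d, rfl⟩ := Nat.exists_eq_add_of_le hij
      rw [hcorr j d hj, Nat.add_sub_cancel_left]
    · obtain ⟨d, rfl⟩ := Nat.exists_eq_add_of_le (not_le.1 hij).le
      rw [Nat.add_sub_cancel_left, ← hcorr i d hi, ← Complex.norm_conj, map_sum]
      simp only [map_mul, Complex.conj_conj, mul_comm]
  rw [hsum] at main
  have hH' : (0 : ℝ) < H := by exact_mod_cast hH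
  have := main.trans (mul_le_mul_of_nonneg_left hb (by positivity))
  refine le_of_mul_le_mul_left ?_ hH'
  calc _ = (H : ℝ) ^ 2 * ‖∑ n ∈ range N, expCircle (f n)‖ ^ 2 := by ring
    _ ≤ _ := this
    _ = _ := by ring

/-! ### Approximation of ζ by partial sums. -/

/-- `s - 1` times the error of the trapezoidal rule for `∫ x^{-s}` over `[a, a + 1]`. -/
def trapTerm (a : ℝ) (s : ℂ) : ℂ :=
  (s - 1) * (((a : ℂ) ^ (-s) + ((a + 1 : ℝ) : ℂ) ^ (-s)) / 2) -
    ((a : ℂ) ^ (1 - s) - ((a + 1 : ℝ) : ℂ) ^ (1 - s))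

lemma trapTerm_one (a : ℝ) : trapTerm a 1 = 0 := by simp [trapTerm]

/-- A primitive whose increment over `[a, a + 1]` is `trapTerm a s`. -/
def trapPrimitive (a : ℝ) (s : ℂ) (x : ℝ) : ℂ :=
  (s - 1) * (((x - a - 1 / 2 : ℝ) : ℂ) * (x : ℂ) ^ (-s)) + (x : ℂ) ^ (1 - s)

lemma trapPrimitive_sub (a : ℝ) (s : ℂ) :
    trapPrimitive a s (a + 1) - trapPrimitive a s a = trapTerm a s := by
  simp only [trapPrimitive, trapTerm]
  push_cast
  ring

lemma hasDerivAt_trapPrimitive (a : ℝ) {s : ℂ} (hs : s ≠ 0) (hs1 : s ≠ 1) {x : ℝ} (hx : 0 < x) :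
    HasDerivAt (trapPrimitive a s)
      (-((s - 1) * s) * ((x - a - 1 / 2 : ℝ) : ℂ) * (x : ℂ) ^ (-s - 1)) x := by
  have h1 := hasDerivAt_ofReal_cpow_const hx.ne' (neg_ne_zero.2 hs)
  have h2 := hasDerivAt_ofReal_cpow_const hx.ne' (sub_ne_zero.2 hs1.symm)
  have h3 : HasDerivAt (fun y : ℝ => ((y - a - 1 / 2 : ℝ) : ℂ)) ((1 : ℝ) : ℂ) x :=
    (((hasDerivAt_id x).sub_const a).sub_const (1 / 2)).ofReal_comp
  have h4 := ((h3.mul h1).const_mul (s - 1)).add h2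
  refine h4.congr_deriv ?_
  rw [show (1 : ℂ) - s - 1 = -s by ring]
  push_cast
  ring

lemma norm_deriv_trapPrimitive_le (a : ℝ) (s : ℂ) {x : ℝ} (hx : 0 < x) (h : a ≤ x)
    (h' : x ≤ a + 1) :
    ‖-((s - 1) * s) * ((x - a - 1 / 2 : ℝ) : ℂ) * (x : ℂ) ^ (-s - 1)‖ ≤
      ‖s - 1‖ * ‖s‖ / 2 * x ^ (-s.re - 1) := by
  rw [norm_mul, norm_mul, norm_neg, norm_mul, Complex.norm_real,
    Complex.norm_cpow_eq_rpow_re_of_pos hx]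
  simp only [Complex.sub_re, Complex.neg_re, Complex.one_re]
  have : ‖x - a - 1 / 2‖ ≤ 1 / 2 := by
    rw [Real.norm_eq_abs, abs_le]; constructor <;> linarith
  have h0 : 0 ≤ ‖s - 1‖ * ‖s‖ := by positivity
  calc _ ≤ ‖s - 1‖ * ‖s‖ * (1 / 2) * x ^ (-s.re - 1) := by gcongr
    _ = _ := by ring

/-- The primitive has derivative of norm at most a constant times x^{-σ-1}, because |x - a - 1/2| ≤
1/2. Comparison with the primitive of that majorant gives a bound which telescopes over consecutive
a. -/
lemma norm_trapTerm_le_sub {a : ℝ} (ha : 0 < a) {s : ℂ} (hs : 0 < s.re) :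
    ‖trapTerm a s‖ ≤ ‖s - 1‖ * ‖s‖ / (2 * s.re) * (a ^ (-s.re) - (a + 1) ^ (-s.re)) := by
  rcases eq_or_ne s 1 with rfl | hs1
  · simp [trapTerm_one]
  have hs0 : s ≠ 0 := by rintro rfl; simp at hs
  rw [← trapPrimitive_sub]
  set K := ‖s - 1‖ * ‖s‖ / (2 * s.re) with hK
  have hd : ∀ x ∈ Set.Icc a (a + 1), HasDerivAt (fun y => trapPrimitive a s y - trapPrimitive a s a)
      (-((s - 1) * s) * ((x - a - 1 / 2 : ℝ) : ℂ) * (x : ℂ) ^ (-s - 1)) x := fun x hx =>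
    (hasDerivAt_trapPrimitive a hs0 hs1 (ha.trans_le hx.1)).sub_const _
  have hB : ∀ x ∈ Set.Icc a (a + 1), HasDerivAt (fun y : ℝ => K * (a ^ (-s.re) - y ^ (-s.re)))
      (‖s - 1‖ * ‖s‖ / 2 * x ^ (-s.re - 1)) x := fun x hx => by
    have := ((Real.hasDerivAt_rpow_const (x := x) (p := -s.re)
      (Or.inl (ha.trans_le hx.1).ne')).const_sub (a ^ (-s.re))).const_mul K
    refine this.congr_deriv ?_
    rw [hK]
    field_simp
  exact image_norm_le_of_norm_deriv_right_le_deriv_boundary'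
    (fun x hx => (hd x hx).continuousAt.continuousWithinAt)
    (fun x hx => (hd x (Set.Ico_subset_Icc_self hx)).hasDerivWithinAt) (by simp)
    (fun x hx => (hB x hx).continuousAt.continuousWithinAt)
    (fun x hx => (hB x (Set.Ico_subset_Icc_self hx)).hasDerivWithinAt)
    (fun x hx => norm_deriv_trapPrimitive_le a s (ha.trans_le hx.1) hx.1 hx.2.le)
    (Set.right_mem_Icc.2 (by linarith))

/-- This form has no σ in a denominator and is easily made uniform in s; it provides the summable
majorant for analyticity of the series. -/
lemma norm_trapTerm_le {a : ℝ} (ha : 0 < a) {s : ℂ} (hs : 0 < s.re) :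
    ‖trapTerm a s‖ ≤ ‖s - 1‖ * ‖s‖ / 2 * a ^ (-s.re - 1) := by
  rcases eq_or_ne s 1 with rfl | hs1
  · simp [trapTerm_one]
  have hs0 : s ≠ 0 := by rintro rfl; simp at hs
  rw [← trapPrimitive_sub]
  have := norm_image_sub_le_of_norm_deriv_le_segment' (a := a) (b := a + 1)
    (f := trapPrimitive a s) (C := ‖s - 1‖ * ‖s‖ / 2 * a ^ (-s.re - 1))
    (fun x hx => (hasDerivAt_trapPrimitive a hs0 hs1 (ha.trans_le hx.1)).hasDerivWithinAt)
    (fun x hx => (norm_deriv_trapPrimitive_le a s (ha.trans_le hx.1) hx.1 hx.2.le).trans (by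
      gcongr ?_ * ?_
      exact Real.rpow_le_rpow_of_nonpos ha hx.1 (by linarith)))
    (a + 1) (Set.right_mem_Icc.2 (by linarith))
  simpa using this

lemma sum_trapTerm {N : ℕ} (s : ℂ) (M : ℕ) :
    ∑ n ∈ range M, trapTerm ((N + n : ℕ) : ℝ) s =
      (s - 1) * (∑ n ∈ range (N + M + 1), 1 / (n : ℂ) ^ s - ∑ n ∈ range (N + 1), 1 / (n : ℂ) ^ s
        + ((N : ℂ) ^ (-s) - ((N + M : ℕ) : ℂ) ^ (-s)) / 2) -
      ((N : ℂ) ^ (1 - s) - ((N + M : ℕ) : ℂ) ^ (1 - s)) := by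
  induction M with
  | zero => simp
  | succ M ih =>
    rw [sum_range_succ, ih, show N + (M + 1) + 1 = (N + M + 1) + 1 by ring,
      sum_range_succ _ (N + M + 1), one_div, ← Complex.cpow_neg, trapTerm]
    push_cast
    rw [show (N : ℂ) + (M + 1) = N + M + 1 by ring]
    ring

lemma tendsto_natCast_add_cpow {N : ℕ} {s : ℂ} (hs : s.re < 0) :
    Filter.Tendsto (fun M : ℕ => ((N + M : ℕ) : ℂ) ^ s) Filter.atTop (nhds 0) := by
  rw [tendsto_zero_iff_norm_tendsto_zero]
  have h1 : Filter.Tendsto (fun M : ℕ => ((N + M : ℕ) : ℝ)) Filter.atTop Filter.atTop :=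
    tendsto_natCast_atTop_atTop.comp (Filter.tendsto_atTop_mono (fun M => Nat.le_add_left M N)
      Filter.tendsto_id)
  have h2 := (tendsto_rpow_neg_atTop (neg_pos.2 hs)).comp h1
  rw [neg_neg] at h2
  refine h2.congr' ?_
  filter_upwards [Filter.eventually_gt_atTop 0] with M hM
  simp only [Function.comp]
  rw [Complex.norm_natCast_cpow_of_pos (by omega)]

lemma tsum_trapTerm_of_one_lt_re {N : ℕ} (hN : 0 < N) {s : ℂ} (hs : 1 < s.re)
    (hsum : Summable fun n : ℕ => trapTerm ((N + n : ℕ) : ℝ) s) :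
    ∑' n : ℕ, trapTerm ((N + n : ℕ) : ℝ) s =
      (s - 1) * (riemannZeta s - ∑ n ∈ range (N + 1), 1 / (n : ℂ) ^ s + (N : ℂ) ^ (-s) / 2) -
        (N : ℂ) ^ (1 - s) := by
  refine tendsto_nhds_unique hsum.hasSum.tendsto_sum_nat ?_
  simp_rw [sum_trapTerm]
  have h1 : Filter.Tendsto (fun M : ℕ => ∑ n ∈ range (N + M + 1), 1 / (n : ℂ) ^ s) Filter.atTop
      (nhds (riemannZeta s)) := by
    rw [zeta_eq_tsum_one_div_nat_cpow hs]
    refine ((Complex.summable_one_div_nat_cpow.2 hs).hasSum.tendsto_sum_nat).comp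
      (Filter.tendsto_atTop_mono (fun M => ?_) Filter.tendsto_id)
    simp only [id]; omega
  have h2 : Filter.Tendsto (fun M : ℕ => ((N + M : ℕ) : ℂ) ^ (-s)) Filter.atTop (nhds 0) :=
    tendsto_natCast_add_cpow (by simp; linarith)
  have h3 : Filter.Tendsto (fun M : ℕ => ((N + M : ℕ) : ℂ) ^ (1 - s)) Filter.atTop (nhds 0) :=
    tendsto_natCast_add_cpow (by simp; linarith)
  have := (((h1.sub_const (∑ n ∈ range (N + 1), 1 / (n : ℂ) ^ s)).add
    ((h2.const_sub ((N : ℂ) ^ (-s))).div_const 2)).const_mul (s - 1)).sub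
    (h3.const_sub ((N : ℂ) ^ (1 - s)))
  simpa using this

lemma differentiable_trapTerm {a : ℝ} (ha : 0 < a) : Differentiable ℂ (trapTerm a) := by
  have h1 : (a : ℂ) ≠ 0 := by exact_mod_cast ha.ne'
  have h2 : ((a + 1 : ℝ) : ℂ) ≠ 0 := by exact_mod_cast (by linarith : a + 1 ≠ 0)
  unfold trapTerm
  intro s
  refine DifferentiableAt.sub (DifferentiableAt.mul (by fun_prop)
    (DifferentiableAt.div_const (DifferentiableAt.add ?_ ?_) _)) (DifferentiableAt.sub ?_ ?_)
  all_goals exact DifferentiableAt.const_cpow (by fun_prop) (Or.inl (by assumption))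

/-- Analytic continuation from Re s > 1. The factor s - 1 removes the pole, so both sides are
analytic throughout the half plane and no puncture at 1 is needed. -/
lemma tsum_trapTerm {N : ℕ} (hN : 0 < N) {s : ℂ} (hs : 0 < s.re) :
    ∑' n : ℕ, trapTerm ((N + n : ℕ) : ℝ) s =
      riemannZeta₁ s - (s - 1) * (∑ n ∈ range (N + 1), 1 / (n : ℂ) ^ s - (N : ℂ) ^ (-s) / 2) -
        (N : ℂ) ^ (1 - s) := by
  set σ := min (s.re / 2) 1 with hσ
  have hσ0 : 0 < σ := lt_min (by linarith) one_pos
  -- A convex region joining s to 2, bounded and away from Re z = 0, so that one majorant serves for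
  -- all z in it.
  set U : Set ℂ := {z | σ < z.re} ∩ Metric.ball 0 (‖s‖ + 3) with hU
  have hUo : IsOpen U := (isOpen_lt continuous_const Complex.continuous_re).inter Metric.isOpen_ball
  have hUc : IsPreconnected U :=
    ((convex_halfSpace_re_gt σ).inter (convex_ball _ _)).isPreconnected
  have hpos : ∀ n : ℕ, (0 : ℝ) < ((N + n : ℕ) : ℝ) := fun n => by exact_mod_cast (by omega)
  have h2U : (2 : ℂ) ∈ U := by
    refine ⟨?_, ?_⟩
    · simp only [Set.mem_ofPred_eq, Complex.re_ofNat]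
      exact (min_le_right _ _).trans_lt (by norm_num)
    · simp; linarith [norm_nonneg s]
  have hsU : s ∈ U := by
    refine ⟨?_, ?_⟩
    · simp only [Set.mem_ofPred_eq]
      exact (min_le_left _ _).trans_lt (by linarith)
    · simp
  set C := (‖s‖ + 4) * (‖s‖ + 3) / 2 with hC
  have hbd : ∀ (n : ℕ) (z : ℂ), z ∈ U →
      ‖trapTerm ((N + n : ℕ) : ℝ) z‖ ≤ C * ((N + n : ℕ) : ℝ) ^ (-σ - 1) := by
    intro n z hz
    have hz1 : σ < z.re := hz.1
    have hz2 : ‖z‖ < ‖s‖ + 3 := by simpa using hz.2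
    refine (norm_trapTerm_le (hpos n) (hσ0.trans hz1)).trans ?_
    have h3 : ‖z - 1‖ ≤ ‖s‖ + 4 := (norm_sub_le _ _).trans (by simp; linarith)
    have h4 : ((N + n : ℕ) : ℝ) ^ (-z.re - 1) ≤ ((N + n : ℕ) : ℝ) ^ (-σ - 1) :=
      Real.rpow_le_rpow_of_exponent_le (by exact_mod_cast (by omega)) (by linarith)
    rw [hC]
    gcongr
  have hsumm : Summable fun n : ℕ => C * ((N + n : ℕ) : ℝ) ^ (-σ - 1) := by
    refine Summable.mul_left _ ?_
    have := (summable_nat_add_iff N).2 (Real.summable_nat_rpow.2 (by linarith : -σ - 1 < -1))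
    simpa only [add_comm N] using this
  have hdiff := Complex.differentiableOn_tsum_of_summable_norm hsumm
    (fun n => (differentiable_trapTerm (hpos n)).differentiableOn) hUo hbd
  have hNc : (N : ℂ) ≠ 0 := by exact_mod_cast hN.ne'
  have hdiff2 : DifferentiableOn ℂ (fun z => riemannZeta₁ z -
      (z - 1) * (∑ n ∈ range (N + 1), 1 / (n : ℂ) ^ z - (N : ℂ) ^ (-z) / 2) -
        (N : ℂ) ^ (1 - z)) U := by
    intro z hz
    have hz0 : z ≠ 0 := by
      rintro rfl
      have := hσ0.trans hz.1
      simp at this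
    refine DifferentiableAt.differentiableWithinAt ?_
    refine DifferentiableAt.sub (DifferentiableAt.sub (differentiable_riemannZeta₁ z)
      (DifferentiableAt.mul (by fun_prop) (DifferentiableAt.sub ?_ ?_))) ?_
    · refine DifferentiableAt.fun_sum fun n _ => ?_
      simp_rw [one_div, ← Complex.cpow_neg]
      exact DifferentiableAt.const_cpow (by fun_prop) (Or.inr (neg_ne_zero.2 hz0))
    · exact (DifferentiableAt.const_cpow (by fun_prop) (Or.inl hNc)).div_const _
    · exact DifferentiableAt.const_cpow (by fun_prop) (Or.inl hNc)
  refine AnalyticOnNhd.eqOn_of_preconnected_of_eventuallyEq (hdiff.analyticOnNhd hUo)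
    (hdiff2.analyticOnNhd hUo) hUc h2U ?_ hsU
  have hnhd : U ∩ {z | 1 < z.re} ∈ nhds (2 : ℂ) :=
    (hUo.inter (isOpen_lt continuous_const Complex.continuous_re)).mem_nhds ⟨h2U, by simp⟩
  filter_upwards [hnhd] with z hz
  have hz1 : (1 : ℝ) < z.re := hz.2
  have hzne : z ≠ 1 := by rintro rfl; simp at hz1
  rw [tsum_trapTerm_of_one_lt_re hN hz1
    (Summable.of_norm_bounded hsumm fun n => hbd n z hz.1), riemannZeta_eq_inv_sub_mul hzne]
  have := sub_ne_zero.2 hzne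
  field_simp
  ring

lemma norm_tsum_trapTerm_le {N : ℕ} (hN : 0 < N) {s : ℂ} (hs : 0 < s.re) :
    ‖∑' n : ℕ, trapTerm ((N + n : ℕ) : ℝ) s‖ ≤
      ‖s - 1‖ * ‖s‖ / (2 * s.re) * (N : ℝ) ^ (-s.re) := by
  have hpos : ∀ n : ℕ, (0 : ℝ) < ((N + n : ℕ) : ℝ) := fun n => by exact_mod_cast (by omega)
  set u : ℕ → ℝ := fun n => ((N + n : ℕ) : ℝ) ^ (-s.re) with hu
  have hanti : ∀ n, 0 ≤ u n - u (n + 1) := fun n => sub_nonneg.2 <|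
    Real.rpow_le_rpow_of_nonpos (hpos n) (by exact_mod_cast (by omega)) (by linarith)
  have hlim : Filter.Tendsto u Filter.atTop (nhds 0) :=
    (tendsto_rpow_neg_atTop hs).comp (tendsto_natCast_atTop_atTop.comp
      (Filter.tendsto_atTop_mono (fun M => Nat.le_add_left M N) Filter.tendsto_id))
  have hsum : HasSum (fun n => u n - u (n + 1)) (u 0) := by
    rw [hasSum_iff_tendsto_nat_of_nonneg hanti]
    simp_rw [sum_range_sub']
    simpa using hlim.const_sub (u 0)
  have := tsum_of_norm_bounded (hsum.mul_left (‖s - 1‖ * ‖s‖ / (2 * s.re))) (fun n => by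
    refine (norm_trapTerm_le_sub (hpos n) hs).trans_eq ?_
    simp only [hu]
    push_cast
    rw [add_assoc])
  simpa [hu] using this

/-- Approximation of `ζ(s)` by a partial sum in the half plane `Re s > 0`. -/
lemma norm_riemannZeta_sub_sum_le {N : ℕ} (hN : 0 < N) {s : ℂ} (hs : 0 < s.re) (hs1 : s ≠ 1) :
    ‖riemannZeta s - ∑ n ∈ Icc 1 N, 1 / (n : ℂ) ^ s‖ ≤
      (N : ℝ) ^ (1 - s.re) / ‖s - 1‖ + (N : ℝ) ^ (-s.re) / 2 +
        ‖s‖ / (2 * s.re) * (N : ℝ) ^ (-s.re) := by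
  have h1 := tsum_trapTerm hN hs
  have h2 := norm_tsum_trapTerm_le hN hs
  have hs0 : s ≠ 0 := by rintro rfl; simp at hs
  have hne := sub_ne_zero.2 hs1
  -- The term n = 0 vanishes: 0^s = 0 for s ≠ 0, and 1 / 0 = 0.
  have hsum : ∑ n ∈ range (N + 1), 1 / (n : ℂ) ^ s = ∑ n ∈ Icc 1 N, 1 / (n : ℂ) ^ s := by
    rw [range_eq_Ico, sum_eq_sum_Ico_succ_bot (by omega)]
    simp only [Nat.cast_zero, Complex.zero_cpow hs0, div_zero, zero_add]
    rfl
  rw [hsum] at h1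
  set T := ∑' n : ℕ, trapTerm ((N + n : ℕ) : ℝ) s
  have e : riemannZeta s - ∑ n ∈ Icc 1 N, 1 / (n : ℂ) ^ s =
      (N : ℂ) ^ (1 - s) / (s - 1) - (N : ℂ) ^ (-s) / 2 + T / (s - 1) := by
    rw [riemannZeta_eq_inv_sub_mul hs1, h1]
    field_simp
    ring
  rw [e]
  refine (norm_add_le _ _).trans (add_le_add ((norm_sub_le _ _).trans (add_le_add ?_ ?_)) ?_)
  · rw [norm_div, Complex.norm_natCast_cpow_of_pos hN]; simp
  · rw [norm_div, Complex.norm_natCast_cpow_of_pos hN]; simp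
  · rw [norm_div, div_le_iff₀ (norm_pos_iff.2 hne)]
    refine h2.trans_eq ?_
    ring

/-! ### Differences of the logarithm and the derivative tests for zeta sums. -/

/-- Minus the second difference of the logarithm at `x`. -/
def logSecondDiff (x : ℝ) : ℝ := 2 * Real.log (x + 1) - Real.log x - Real.log (x + 2)

lemma logSecondDiff_eq {x : ℝ} (hx : 0 < x) :
    logSecondDiff x = -Real.log (1 - 1 / (x + 1) ^ 2) := by
  have : 1 - 1 / (x + 1) ^ 2 = x * (x + 2) / (x + 1) ^ 2 := by field_simp; ring
  rw [logSecondDiff, this, Real.log_div (by positivity) (by positivity),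
    Real.log_mul (by positivity) (by positivity), Real.log_pow]
  push_cast
  ring

lemma one_sub_inv_sq_pos {x : ℝ} (hx : 0 < x) : 0 < 1 - 1 / (x + 1) ^ 2 := by
  rw [show 1 - 1 / (x + 1) ^ 2 = x * (x + 2) / (x + 1) ^ 2 by field_simp; ring]
  positivity

lemma le_logSecondDiff {x : ℝ} (hx : 0 < x) : 1 / (x + 1) ^ 2 ≤ logSecondDiff x := by
  rw [logSecondDiff_eq hx]
  linarith [Real.log_le_sub_one_of_pos (one_sub_inv_sq_pos hx)]

/-- With u = (x+1)^{-2} and v = (x+d+1)^{-2}, the right side is -log((1-u)/(1-v)), which is at least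
u - v by log y ≤ y - 1. This plays the part of a third derivative lower bound. -/
lemma le_logSecondDiff_sub {x d : ℝ} (hx : 0 < x) (hd : 0 ≤ d) :
    2 * d / (x + d + 1) ^ 3 ≤ logSecondDiff x - logSecondDiff (x + d) := by
  have hxd : 0 < x + d := by linarith
  rw [logSecondDiff_eq hx, logSecondDiff_eq hxd]
  have hu := one_sub_inv_sq_pos hx
  have hv := one_sub_inv_sq_pos hxd
  have hv0 : 0 < 1 / (x + d + 1) ^ 2 := by positivity
  set u := 1 / (x + 1) ^ 2 with hu'
  set v := 1 / (x + d + 1) ^ 2 with hv'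
  have h1 := Real.log_le_sub_one_of_pos (div_pos hu hv)
  rw [Real.log_div hu.ne' hv.ne'] at h1
  have h2 : 2 * d / (x + d + 1) ^ 3 ≤ u - v := by
    have e : u - v = d * (2 * (x + 1) + d) / ((x + 1) ^ 2 * (x + d + 1) ^ 2) := by
      rw [hu', hv']; field_simp; ring
    rw [e, div_le_div_iff₀ (by positivity) (by positivity)]
    have : 2 * (x + 1) ^ 2 ≤ (2 * (x + 1) + d) * (x + d + 1) := by nlinarith
    calc 2 * d * ((x + 1) ^ 2 * (x + d + 1) ^ 2) = d * (x + d + 1) ^ 2 * (2 * (x + 1) ^ 2) := by ring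
      _ ≤ d * (x + d + 1) ^ 2 * ((2 * (x + 1) + d) * (x + d + 1)) := by gcongr
      _ = _ := by ring
  have h3 : (1 - u) / (1 - v) - 1 ≤ -(u - v) := by
    have h4 : 0 ≤ u - v := le_trans (by positivity) h2
    rw [div_sub_one hv.ne', div_le_iff₀ hv]
    nlinarith
  linarith

lemma log_add_one_sub_log_le {x : ℝ} (hx : 0 < x) : Real.log (x + 1) - Real.log x ≤ 1 / x := by
  rw [← Real.log_div (by positivity) hx.ne']
  refine (Real.log_le_sub_one_of_pos (by positivity)).trans_eq ?_
  field_simp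
  ring

lemma log_le_log_add_one {x : ℝ} (hx : 0 < x) : Real.log x ≤ Real.log (x + 1) :=
  Real.log_le_log hx (by linarith)

lemma log_mixed_diff_le {x d : ℝ} (hx : 0 < x) (hd : 0 ≤ d) :
    (Real.log (x + 1) - Real.log x) - (Real.log (x + d + 1) - Real.log (x + d)) ≤ d / x ^ 2 := by
  have hxd : 0 < x + d := by linarith
  have h1 := Real.log_le_sub_one_of_pos
    (show 0 < ((x + 1) * (x + d)) / (x * (x + d + 1)) by positivity)
  rw [Real.log_div (by positivity) (by positivity), Real.log_mul (by positivity) (by positivity),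
    Real.log_mul (by positivity) (by positivity)] at h1
  have h2 : ((x + 1) * (x + d)) / (x * (x + d + 1)) - 1 = d / (x * (x + d + 1)) := by
    field_simp; ring
  have h3 : d / (x * (x + d + 1)) ≤ d / x ^ 2 := by
    apply div_le_div_of_nonneg_left hd (by positivity)
    nlinarith
  linarith

lemma log_mixed_diff_nonneg {x d : ℝ} (hx : 0 < x) (hd : 0 ≤ d) :
    0 ≤ (Real.log (x + 1) - Real.log x) - (Real.log (x + d + 1) - Real.log (x + d)) := by
  have hxd : 0 < x + d := by linarith
  rw [← Real.log_div (by positivity) (by positivity), ← Real.log_div (by positivity) (by positivity),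
    sub_nonneg]
  apply Real.log_le_log (by positivity)
  rw [div_le_div_iff₀ hxd hx]
  nlinarith

lemma vdcA_nonneg : 0 ≤ vdcA := by rw [vdcA]; positivity

lemma vdcA_le_three : vdcA ≤ 3 := by
  have h1 : (1.7 : ℝ) ≤ √Real.pi := by
    apply Real.le_sqrt_of_sq_le; linarith [Real.pi_gt_three]
  have h2 : √(1 + 3 * Real.pi / 8) ≤ 1.5 := by
    rw [Real.sqrt_le_left (by norm_num)]; linarith [Real.pi_lt_d2]
  rw [vdcA]
  calc 2 / √Real.pi * (1 + √(1 + 3 * Real.pi / 8)) ≤ 2 / 1.7 * (1 + 1.5) := by gcongr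
    _ ≤ 3 := by norm_num

/-- The second derivative test for zeta sums. -/
lemma norm_zetaSum_le_second {τ X : ℝ} (hτ : 0 < τ) (hX : 0 < X) (hτX : τ ≤ X ^ 2) {m N : ℕ}
    (hm : X ≤ m) (hN : (m + N : ℝ) ≤ 2 * X + 1) :
    ‖∑ i ∈ range N, expCircle (-τ * Real.log ((m + i : ℕ) : ℝ))‖ ≤
      2 * vdcA * (√τ + 2 * X / √τ) := by
  have hpos : ∀ i : ℕ, X ≤ ((m + i : ℕ) : ℝ) := fun i => by
    push_cast; linarith [Nat.cast_nonneg (α := ℝ) i]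
  have hl : 0 < τ / (4 * X ^ 2) := by positivity
  have e1 : ∀ i : ℕ, ((m + (i + 1) : ℕ) : ℝ) = ((m + i : ℕ) : ℝ) + 1 := fun i => by push_cast; ring
  have key := norm_sum_expCircle_le_of_second_difference
    (fun i => -τ * Real.log ((m + i : ℕ) : ℝ)) N hl
    (by rw [div_le_div_iff₀ (by positivity) (by norm_num)]; linarith) (V := τ / X)
    (fun i hi => by
      simp only [e1]
      have h0 := hX.trans_le (hpos i)
      have h1 := le_logSecondDiff h0
      -- The second difference is centred at m + i + 1 ≤ m + N - 1, the last point of the block;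
      -- hence the bound 2X + 1 on m + N.
      have hi' : ((m + i : ℕ) : ℝ) + 1 ≤ 2 * X := by
        have : (i : ℝ) + 1 + 1 ≤ N := by exact_mod_cast hi
        push_cast; linarith
      have h2 : 1 / (2 * X) ^ 2 ≤ 1 / (((m + i : ℕ) : ℝ) + 1) ^ 2 := by gcongr
      have h3 := mul_le_mul_of_nonneg_left (h2.trans h1) hτ.le
      have h4 : τ / (4 * X ^ 2) = τ * (1 / (2 * X) ^ 2) := by field_simp; ring
      rw [logSecondDiff, show ((m + i : ℕ) : ℝ) + 2 = ((m + i : ℕ) : ℝ) + 1 + 1 by ring] at h3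
      rw [h4]
      linarith)
    (fun i hi j hj => by
      simp only [e1]
      have h1 := log_add_one_sub_log_le (hX.trans_le (hpos i))
      have h2 := log_le_log_add_one (hX.trans_le (hpos j))
      have h3 : 1 / ((m + i : ℕ) : ℝ) ≤ 1 / X := one_div_le_one_div_of_le hX (hpos i)
      have h4 := mul_le_mul_of_nonneg_left (h1.trans h3) hτ.le
      have h5 := mul_le_mul_of_nonneg_left h2 hτ.le
      rw [div_eq_mul_one_div]
      linarith) (by positivity)
  refine key.trans_eq ?_
  rw [Real.sqrt_div' _ (by positivity), show 4 * X ^ 2 = (2 * X) ^ 2 by ring,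
    Real.sqrt_sq (by positivity)]
  have hs : √τ ^ 2 = τ := Real.sq_sqrt hτ.le
  have hs0 : 0 < √τ := Real.sqrt_pos.2 hτ
  nth_rw 1 [← hs]
  field_simp

lemma norm_sum_expCircle_neg (f : ℕ → ℝ) (N : ℕ) :
    ‖∑ n ∈ range N, expCircle (-f n)‖ = ‖∑ n ∈ range N, expCircle (f n)‖ := by
  rw [← Complex.norm_conj (∑ n ∈ range N, expCircle (f n)), map_sum]
  simp_rw [conj_expCircle]

/-- The second derivative test for differenced zeta sums. -/
lemma norm_zetaSum_diff_le {τ X : ℝ} (hτ : 0 < τ) (hX : 0 < X) (hτX : τ ≤ X ^ 2) {m N d : ℕ}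
    (hm : X ≤ m) (hN : (m + N : ℝ) ≤ 2 * X + 1) (hd : 0 < d) (hdX : (d : ℝ) ≤ X) :
    ‖∑ i ∈ range (N - d), expCircle (-τ * Real.log ((m + (i + d) : ℕ) : ℝ) -
        -τ * Real.log ((m + i : ℕ) : ℝ))‖ ≤
      vdcA * (d * τ / X ^ 2 + 2) / √(d * τ / (4 * X ^ 3)) := by
  have hpos : ∀ i : ℕ, X ≤ ((m + i : ℕ) : ℝ) := fun i => by
    push_cast; linarith [Nat.cast_nonneg (α := ℝ) i]
  have hd' : (0 : ℝ) < d := by exact_mod_cast hd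
  have hl : 0 < d * τ / (4 * X ^ 3) := by positivity
  have e0 : ∀ i : ℕ, ((m + (i + d) : ℕ) : ℝ) = ((m + i : ℕ) : ℝ) + d := fun i => by
    push_cast; ring
  have e1 : ∀ i : ℕ, ((m + (i + 1) : ℕ) : ℝ) = ((m + i : ℕ) : ℝ) + 1 := fun i => by push_cast; ring
  -- The differenced phase is concave; conjugation makes its second differences positive.
  rw [← norm_sum_expCircle_neg]
  refine norm_sum_expCircle_le_of_second_difference
    (fun i => -(-τ * Real.log ((m + (i + d) : ℕ) : ℝ) - -τ * Real.log ((m + i : ℕ) : ℝ))) (N - d)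
    hl ?_ (V := d * τ / X ^ 2) (fun i hi => ?_) (fun i hi j hj => ?_) (by positivity)
  · rw [div_le_div_iff₀ (by positivity) (by norm_num)]
    nlinarith [mul_le_mul hdX hτX hτ.le hX.le]
  · simp only [e0, e1]
    have h0 := hX.trans_le (hpos i)
    have h1 := le_logSecondDiff_sub h0 hd'.le
    have hi' : ((m + i : ℕ) : ℝ) + d + 1 ≤ 2 * X := by
      have h : i + d + 1 + 1 ≤ N := by omega
      have : (i : ℝ) + d + 1 + 1 ≤ N := by exact_mod_cast h
      push_cast; linarith
    have h2 : 2 * (d : ℝ) / (2 * X) ^ 3 ≤ 2 * d / (((m + i : ℕ) : ℝ) + d + 1) ^ 3 := by gcongr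
    have h3 := mul_le_mul_of_nonneg_left (h2.trans h1) hτ.le
    have h4 : d * τ / (4 * X ^ 3) = τ * (2 * d / (2 * X) ^ 3) := by field_simp; ring
    rw [logSecondDiff, logSecondDiff,
      show ((m + i : ℕ) : ℝ) + 2 = ((m + i : ℕ) : ℝ) + 1 + 1 by ring,
      show ((m + i : ℕ) : ℝ) + d + 2 = ((m + i : ℕ) : ℝ) + 1 + 1 + d by ring] at h3
    rw [h4, show ((m + i : ℕ) : ℝ) + 1 + d = ((m + i : ℕ) : ℝ) + d + 1 by ring]
    linarith
  · simp only [e0, e1]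
    have h1 := log_mixed_diff_le (hX.trans_le (hpos i)) hd'.le
    have h2 := log_mixed_diff_nonneg (hX.trans_le (hpos j)) hd'.le
    have h3 : (d : ℝ) / ((m + i : ℕ) : ℝ) ^ 2 ≤ d / X ^ 2 := by
      gcongr
      exact hpos i
    have h4 := mul_le_mul_of_nonneg_left (h1.trans h3) hτ.le
    have h5 := mul_le_mul_of_nonneg_left h2 hτ.le
    rw [show (d : ℝ) * τ / X ^ 2 = τ * (d / X ^ 2) by ring,
      show ((m + i : ℕ) : ℝ) + 1 + d = ((m + i : ℕ) : ℝ) + d + 1 by ring,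
      show ((m + j : ℕ) : ℝ) + 1 + d = ((m + j : ℕ) : ℝ) + d + 1 by ring]
    linarith

lemma sum_one_div_sqrt_le (h : ℕ) : ∑ d ∈ Ico 1 (h + 1), 1 / √(d : ℝ) ≤ 2 * √(h : ℝ) := by
  induction h with
  | zero => simp
  | succ h ih =>
    rw [sum_Ico_succ_top (by omega)]
    push_cast
    have hp : 0 < √((h : ℝ) + 1) := Real.sqrt_pos.2 (by positivity)
    have h1 : √((h : ℝ) + 1) ^ 2 = h + 1 := Real.sq_sqrt (by positivity)
    have h2 : √(h : ℝ) ^ 2 = h := Real.sq_sqrt (by positivity)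
    have : 1 / √((h : ℝ) + 1) ≤ 2 * √((h : ℝ) + 1) - 2 * √(h : ℝ) := by
      rw [div_le_iff₀ hp]
      nlinarith [sq_nonneg (√((h : ℝ) + 1) - √(h : ℝ))]
    linarith

lemma vdcA3hat_nonneg : 0 ≤ vdcA3hat := by rw [vdcA3hat]; positivity

/-- The square is 2√2 (4 + 2√2)² = 131.88…, just above the constant in `norm_zetaSum_sq_le_third`.
-/
lemma le_vdcA3hat_sq : 131 ≤ vdcA3hat ^ 2 := by
  have h2 : √(2 : ℝ) ^ 2 = 2 := Real.sq_sqrt (by norm_num)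
  have h3 : (1.41 : ℝ) ≤ √2 := by apply Real.le_sqrt_of_sq_le; norm_num
  have h4 : ((2 : ℝ) ^ (3 / 4 : ℝ)) ^ 2 = 2 * √2 := by
    rw [← Real.rpow_natCast, ← Real.rpow_mul (by norm_num), Real.sqrt_eq_rpow]
    nth_rw 2 [← Real.rpow_one 2]
    rw [← Real.rpow_add (by norm_num)]
    norm_num
  rw [vdcA3hat, mul_pow, h4]
  nlinarith

/-- The third derivative test for zeta sums; here `c = τ^{1/3}`. -/
lemma norm_zetaSum_sq_le_third {c X : ℝ} (hc : 2.71 ≤ c) (hcX : c ^ 3 ≤ X ^ 2) (hXc : X ≤ c ^ 2)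
    (hX0 : 0 < X) {m N : ℕ} (hm : X ≤ m) (hN : (m + N : ℝ) ≤ 2 * X + 1) :
    ‖∑ i ∈ range N, expCircle (-c ^ 3 * Real.log ((m + i : ℕ) : ℝ))‖ ^ 2 ≤ 131 * (X * c) := by
  have hc0 : 0 < c := by linarith
  have hA := vdcA_le_three
  have hA0 := vdcA_nonneg
  have hX : 4.46 ≤ X := by
    by_contra! h
    nlinarith [mul_le_mul hc hc (by norm_num) hc0.le]
  -- The Weyl shift length is H = ⌈X/c⌉ = h + 1, so h ≤ u ≤ H.
  set u := X / c with hu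
  have hu0 : 0 < u := by positivity
  obtain ⟨h, hh⟩ : ∃ h, ⌈u⌉₊ = h + 1 := Nat.exists_eq_succ_of_ne_zero (Nat.ceil_pos.2 hu0).ne'
  have hH1 : u ≤ (h : ℝ) + 1 := by
    have := Nat.le_ceil u
    rw [hh] at this
    exact_mod_cast this
  have hH2 : (h : ℝ) ≤ u := by
    have := Nat.ceil_lt_add_one hu0.le
    rw [hh] at this
    push_cast at this
    linarith
  have weyl := weyl_vdc (fun i => -c ^ 3 * Real.log ((m + i : ℕ) : ℝ)) N (h + 1) (by omega)
  have hterm : ∀ d ∈ Ico 1 (h + 1), ‖∑ i ∈ range (N - d),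
      expCircle (-c ^ 3 * Real.log ((m + (i + d) : ℕ) : ℝ) -
        -c ^ 3 * Real.log ((m + i : ℕ) : ℝ))‖ ≤
      vdcA * (2 * c) + vdcA * 4 * √(X ^ 3 / c ^ 3) * (1 / √(d : ℝ)) := by
    intro d hd
    rw [mem_Ico] at hd
    have hd0 : (0 : ℝ) < d := by exact_mod_cast hd.1
    have hdu : (d : ℝ) ≤ u := le_trans (by exact_mod_cast (by omega)) hH2
    have huX : u ≤ X := by rw [hu]; exact div_le_self hX0.le (by linarith)
    refine (norm_zetaSum_diff_le (by positivity) hX0 hcX hm hN hd.1 (hdu.trans huX)).trans ?_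
    have e1 : √(d * c ^ 3 / (4 * X ^ 3)) = √(d : ℝ) / (2 * √(X ^ 3 / c ^ 3)) := by
      rw [show (d : ℝ) * c ^ 3 / (4 * X ^ 3) = d / (2 ^ 2 * (X ^ 3 / c ^ 3)) by field_simp; ring,
        Real.sqrt_div hd0.le, Real.sqrt_mul (by norm_num), Real.sqrt_sq (by norm_num)]
    have hsd : 0 < √(d : ℝ) := Real.sqrt_pos.2 hd0
    have hq : 0 < √(X ^ 3 / c ^ 3) := Real.sqrt_pos.2 (by positivity)
    have e2 : vdcA * (d * c ^ 3 / X ^ 2 + 2) / √(d * c ^ 3 / (4 * X ^ 3)) =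
        vdcA * (2 * (d * c ^ 3 / X ^ 2 * (√(X ^ 3 / c ^ 3) / √(d : ℝ)))) +
          vdcA * 4 * √(X ^ 3 / c ^ 3) * (1 / √(d : ℝ)) := by
      rw [e1]; field_simp; ring
    rw [e2]
    gcongr
    have e3 : (d * c ^ 3 / X ^ 2 * (√(X ^ 3 / c ^ 3) / √(d : ℝ))) ^ 2 = d * c ^ 3 / X := by
      rw [mul_pow, div_pow (√(X ^ 3 / c ^ 3)), Real.sq_sqrt hd0.le, Real.sq_sqrt (by positivity)]
      field_simp
    -- The square equals d c³ / X, at most c² because d ≤ X / c.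
    refine (abs_le_of_sq_le_sq' (b := c) ?_ hc0.le).2
    rw [e3, div_le_iff₀ hX0]
    rw [hu, le_div_iff₀ hc0] at hdu
    calc (d : ℝ) * c ^ 3 = d * c * c ^ 2 := by ring
      _ ≤ X * c ^ 2 := by gcongr
      _ = c ^ 2 * X := by ring
  have hsum : ∑ d ∈ Ico 1 (h + 1), ‖∑ i ∈ range (N - d),
      expCircle (-c ^ 3 * Real.log ((m + (i + d) : ℕ) : ℝ) -
        -c ^ 3 * Real.log ((m + i : ℕ) : ℝ))‖ ≤ 30 * X := by
    refine (sum_le_sum hterm).trans ?_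
    rw [sum_add_distrib, sum_const, Nat.card_Ico, nsmul_eq_mul, Nat.add_sub_cancel, ← mul_sum]
    have h1 : (h : ℝ) * (vdcA * (2 * c)) ≤ 6 * X := by
      have : (h : ℝ) * c ≤ X := by rwa [hu, le_div_iff₀ hc0] at hH2
      have := mul_le_mul hA this (by positivity) (by norm_num)
      linarith
    -- The condition X ≤ c² = τ^{2/3} enters here.
    have h2 : √(X ^ 3 / c ^ 3) * √(h : ℝ) ≤ X := by
      rw [← Real.sqrt_mul (by positivity)]
      apply Real.sqrt_le_iff.2 ⟨hX0.le, ?_⟩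
      calc X ^ 3 / c ^ 3 * h ≤ X ^ 3 / c ^ 3 * (X / c) := by gcongr
        _ = X ^ 2 * (X / c ^ 2) ^ 2 := by field_simp
        _ ≤ X ^ 2 * 1 ^ 2 := by
            gcongr
            rw [div_le_one (by positivity)]; exact hXc
        _ = X ^ 2 := by ring
    have h3 : vdcA * 4 * √(X ^ 3 / c ^ 3) * ∑ d ∈ Ico 1 (h + 1), 1 / √(d : ℝ) ≤ 24 * X := by
      calc vdcA * 4 * √(X ^ 3 / c ^ 3) * ∑ d ∈ Ico 1 (h + 1), 1 / √(d : ℝ)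
          ≤ vdcA * 4 * √(X ^ 3 / c ^ 3) * (2 * √(h : ℝ)) := by
            gcongr
            exact sum_one_div_sqrt_le h
        _ = 8 * vdcA * (√(X ^ 3 / c ^ 3) * √(h : ℝ)) := by ring
        _ ≤ 8 * 3 * X := by gcongr
        _ = 24 * X := by ring
    linarith
  have hN1 : (N : ℝ) ≤ X + 1 := by linarith
  set S := ‖∑ i ∈ range N, expCircle (-c ^ 3 * Real.log ((m + i : ℕ) : ℝ))‖
  have hS : u * S ^ 2 ≤ (X + 1 + (u + 1)) * (X + 1 + 2 * (30 * X)) := by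
    rw [Nat.cast_succ] at weyl
    refine (mul_le_mul_of_nonneg_right hH1 (sq_nonneg S)).trans (weyl.trans ?_)
    gcongr
  have hu1 : u ≤ X / 2.71 := by rw [hu]; gcongr
  -- From u ≤ X/2.71 and 1 ≤ X/4.46: 1 + 1/2.71 + 2/4.46 < 1.8176 and 61 + 1/4.46 < 61.225.
  have hb : (X + 1 + (u + 1)) * (X + 1 + 2 * (30 * X)) ≤ 131 * X ^ 2 := by
    calc (X + 1 + (u + 1)) * (X + 1 + 2 * (30 * X)) ≤ (1.8176 * X) * (61.225 * X) := by
          apply mul_le_mul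
          · norm_num at *; linarith
          · norm_num at *; linarith
          · positivity
          · positivity
      _ ≤ 131 * X ^ 2 := by nlinarith [sq_nonneg X]
  have := hS.trans hb
  rw [hu, div_mul_eq_mul_div, div_le_iff₀ hc0] at this
  nlinarith

/-- The third derivative test for zeta sums. -/
lemma norm_zetaSum_le_third {τ X : ℝ} (hτ : 20 ≤ τ) (hτX : τ ^ (1 / 2 : ℝ) ≤ X)
    (hXτ : X ≤ τ ^ (2 / 3 : ℝ)) {m N : ℕ} (hm : X ≤ m) (hN : (m + N : ℝ) ≤ 2 * X + 1) :
    ‖∑ i ∈ range N, expCircle (-τ * Real.log ((m + i : ℕ) : ℝ))‖ ≤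
      vdcA3hat * (X ^ (1 / 2 : ℝ) * τ ^ (1 / 6 : ℝ)) := by
  have hτ0 : 0 < τ := by linarith
  have hX0 : 0 < X := (Real.rpow_pos_of_pos hτ0 _).trans_le hτX
  set c := τ ^ (1 / 3 : ℝ) with hc
  have hc3 : c ^ 3 = τ := by
    rw [hc, ← Real.rpow_natCast, ← Real.rpow_mul hτ0.le]; norm_num
  have hc0 : 0 < c := Real.rpow_pos_of_pos hτ0 _
  -- 2.71³ = 19.90… < 20 ≤ τ.
  have hcl : 2.71 ≤ c := by
    by_contra! h
    have : c ^ 3 < 2.71 ^ 3 := by gcongr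
    norm_num at this
    linarith
  have h1 : c ^ 3 ≤ X ^ 2 := by
    rw [hc3]
    calc τ = (τ ^ (1 / 2 : ℝ)) ^ 2 := by
          rw [← Real.rpow_natCast, ← Real.rpow_mul hτ0.le]; norm_num
      _ ≤ X ^ 2 := by gcongr
  have h2 : X ≤ c ^ 2 := by
    refine hXτ.trans_eq ?_
    rw [hc, ← Real.rpow_natCast, ← Real.rpow_mul hτ0.le]; norm_num
  have key := norm_zetaSum_sq_le_third hcl h1 h2 hX0 hm hN
  rw [hc3] at key
  have hA := le_vdcA3hat_sq
  have hA0 := vdcA3hat_nonneg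
  refine (abs_le_of_sq_le_sq' (key.trans ?_) (by positivity)).2
  rw [mul_pow, mul_pow, ← Real.rpow_natCast, ← Real.rpow_natCast (X ^ _),
    ← Real.rpow_natCast (τ ^ _), ← Real.rpow_mul hX0.le, ← Real.rpow_mul hτ0.le]
  norm_num
  have : (1 / 3 : ℝ) = 3⁻¹ := by norm_num
  rw [hc, this]
  gcongr

/-! ### Dirichlet polynomials by dyadic blocks. -/

lemma one_div_cpow_eq {n : ℕ} (hn : 0 < n) (σ τ : ℝ) :
    1 / (n : ℂ) ^ ((σ : ℂ) + ((2 * Real.pi * τ : ℝ) : ℂ) * Complex.I) =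
      (((n : ℝ) ^ (-σ) : ℝ) : ℂ) * expCircle (-τ * Real.log n) := by
  have hnc : (n : ℂ) ≠ 0 := by exact_mod_cast hn.ne'
  rw [one_div, ← Complex.cpow_neg, neg_add, Complex.cpow_add _ _ hnc,
    Complex.ofReal_cpow (Nat.cast_nonneg n), expCircle, Complex.cpow_def_of_ne_zero hnc (-_ : ℂ),
    Complex.cpow_def_of_ne_zero hnc (-(_ * Complex.I)), ← Complex.natCast_log]
  push_cast
  congr 1
  · rw [Complex.cpow_def_of_ne_zero hnc, ← Complex.natCast_log]
  · congr 1
    ring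

/-- Passing from exponential sums to Dirichlet polynomials on a dyadic block. -/
lemma norm_sum_Ioc_one_div_cpow_le {σ τ X M B : ℝ} (hσ : 0 < σ) (hX : 0 < X) (hM : M ≤ 2 * X)
    (hB : ∀ N : ℕ, (((⌊X⌋₊ + 1 : ℕ) : ℝ) + N : ℝ) ≤ 2 * X + 1 →
      ‖∑ i ∈ range N, expCircle (-τ * Real.log ((⌊X⌋₊ + 1 + i : ℕ) : ℝ))‖ ≤ B) :
    ‖∑ n ∈ Ioc ⌊X⌋₊ ⌊M⌋₊, 1 / (n : ℂ) ^ ((σ : ℂ) + ((2 * Real.pi * τ : ℝ) : ℂ) * Complex.I)‖ ≤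
      X ^ (-σ) * B := by
  set m := ⌊X⌋₊ + 1 with hm
  have hXm : X ≤ m := by rw [hm]; exact_mod_cast (Nat.lt_floor_add_one X).le
  have hfl : (⌊X⌋₊ : ℝ) ≤ X := Nat.floor_le hX.le
  have hlen : ∀ k ≤ ⌊M⌋₊ + 1 - m, ((m : ℝ) + k : ℝ) ≤ 2 * X + 1 := by
    intro k hk
    -- The case k = 0 is separate because M may lie below X, where the truncated subtraction carries
    -- no information.
    rcases Nat.eq_zero_or_pos k with rfl | hk0
    · rw [hm]; push_cast; linarith
    · have h1 : m + k ≤ ⌊M⌋₊ + 1 := by omega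
      have h2 : ((m : ℝ) + k : ℝ) ≤ ⌊M⌋₊ + 1 := by exact_mod_cast h1
      have hM0 : 0 ≤ M := by
        by_contra! h
        rw [Nat.floor_of_nonpos h.le] at hk
        omega
      linarith [Nat.floor_le hM0]
  have hB0 : 0 ≤ B := (norm_nonneg _).trans (hB 0 (hlen 0 (by omega)))
  have hset : Ioc ⌊X⌋₊ ⌊M⌋₊ = Ico m (⌊M⌋₊ + 1) := by ext; simp [hm]
  rw [hset, sum_Ico_eq_sum_range]
  rw [sum_congr rfl fun i _ => one_div_cpow_eq (by omega : 0 < m + i) σ τ]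
  refine (norm_sum_mul_le_of_antitone (fun i => ((m + i : ℕ) : ℝ) ^ (-σ)) _ _ ?_ ?_
    (fun k hk => hB k (hlen k hk))).trans ?_
  · intro i j hij
    exact Real.rpow_le_rpow_of_nonpos (by positivity) (by exact_mod_cast (by omega)) (by linarith)
  · intro i; positivity
  · gcongr ?_ * B
    exact Real.rpow_le_rpow_of_nonpos hX (by simpa using hXm) (by linarith)

/-- The free endpoint M' covers both full blocks and the truncated last one. A block bound is
required only when the block starts at or below M, which keeps every block inside the range where
its derivative test is valid. -/
lemma norm_sum_Ioc_le_dyadic (F : ℕ → ℂ) {X M : ℝ} (B : ℕ → ℝ) (K : ℕ) (hX : 0 < X)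
    (hM : M ≤ 2 ^ K * X) (hB0 : ∀ k, 0 ≤ B k)
    (hB : ∀ k < K, ∀ M' ≤ M, 2 ^ k * X ≤ M → M' ≤ 2 * (2 ^ k * X) →
      ‖∑ n ∈ Ioc ⌊2 ^ k * X⌋₊ ⌊M'⌋₊, F n‖ ≤ B k) :
    ‖∑ n ∈ Ioc ⌊X⌋₊ ⌊M⌋₊, F n‖ ≤ ∑ k ∈ range K, B k := by
  induction K generalizing M with
  | zero =>
    have := Nat.floor_le_floor (show M ≤ X by simpa using hM)
    rw [Ioc_eq_empty_of_le this]
    simp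
  | succ K ih =>
    rw [sum_range_succ]
    rcases le_total M (2 ^ K * X) with h | h
    · have := ih h (fun k hk => hB k (by omega))
      linarith [hB0 K]
    · have h1 : X ≤ 2 ^ K * X := le_mul_of_one_le_left hX.le (one_le_pow₀ (by norm_num))
      rw [← sum_Ioc_consecutive F (Nat.floor_le_floor h1) (Nat.floor_le_floor h)]
      refine (norm_add_le _ _).trans (add_le_add (ih le_rfl fun k hk M' hM' hk' hM2 =>
        hB k (by omega) M' (hM'.trans h) (hk'.trans h) hM2) ?_)
      exact hB K (by omega) M le_rfl h (by rw [pow_succ] at hM; linarith)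

lemma sum_geometric_le {r : ℝ} (hr : 0 ≤ r) (hr1 : r < 1) (K : ℕ) :
    ∑ k ∈ range K, r ^ k ≤ 1 / (1 - r) := by
  rw [geom_sum_eq hr1.ne, ← neg_div_neg_eq, neg_sub, neg_sub]
  gcongr
  linarith [pow_nonneg hr K]

lemma two_pow_mul_rpow (k : ℕ) {X : ℝ} (hX : 0 < X) (a : ℝ) :
    (2 ^ k * X) ^ a = ((2 : ℝ) ^ a) ^ k * X ^ a := by
  rw [Real.mul_rpow (by positivity) hX.le, ← Real.rpow_natCast, ← Real.rpow_mul (by norm_num),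
    ← Real.rpow_natCast, ← Real.rpow_mul (by norm_num), mul_comm (k : ℝ)]

/-- The range `√τ < n ≤ τ^{2/3}`. -/
lemma norm_sum_Ioc_le_third {σ τ : ℝ} (hτ : 20 ≤ τ) (hσ : 1 / 2 < σ) :
    ‖∑ n ∈ Ioc ⌊τ ^ (1 / 2 : ℝ)⌋₊ ⌊τ ^ (2 / 3 : ℝ)⌋₊,
        1 / (n : ℂ) ^ ((σ : ℂ) + ((2 * Real.pi * τ : ℝ) : ℂ) * Complex.I)‖ ≤
      vdcA3hat * (2 : ℝ) ^ (σ - 1 / 2) / ((2 : ℝ) ^ (σ - 1 / 2) - 1)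
        * τ ^ (1 / 2 * (5 / 6 - σ)) := by
  have hτ0 : 0 < τ := by linarith
  have hA0 := vdcA3hat_nonneg
  set X := τ ^ (1 / 2 : ℝ) with hX
  have hX0 : 0 < X := Real.rpow_pos_of_pos hτ0 _
  -- Any sufficient number of blocks will do, since the geometric series is bounded independently of
  -- K.
  obtain ⟨K, hK⟩ := pow_unbounded_of_one_lt (τ ^ (2 / 3 : ℝ) / X) (one_lt_two (α := ℝ))
  rw [div_lt_iff₀ hX0] at hK
  set r := (2 : ℝ) ^ (1 / 2 - σ) with hr
  have hr0 : 0 < r := Real.rpow_pos_of_pos (by norm_num) _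
  have hr1 : r < 1 := Real.rpow_lt_one_of_one_lt_of_neg (by norm_num) (by linarith)
  have := norm_sum_Ioc_le_dyadic
    (fun n => 1 / (n : ℂ) ^ ((σ : ℂ) + ((2 * Real.pi * τ : ℝ) : ℂ) * Complex.I))
    (fun k => vdcA3hat * τ ^ (1 / 2 * (5 / 6 - σ)) * r ^ k) K hX0 hK.le
    (fun k => by positivity)
    (fun k _ M' _ hk hM' => by
      have hXk : X ≤ 2 ^ k * X := le_mul_of_one_le_left hX0.le (one_le_pow₀ (by norm_num))
      have hXk0 : 0 < 2 ^ k * X := by positivity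
      refine (norm_sum_Ioc_one_div_cpow_le (by linarith) hXk0 hM' (fun N hN =>
        norm_zetaSum_le_third hτ hXk hk (by
          exact_mod_cast (Nat.lt_floor_add_one (2 ^ k * X)).le) hN)).trans_eq ?_
      calc (2 ^ k * X) ^ (-σ) * (vdcA3hat * ((2 ^ k * X) ^ (1 / 2 : ℝ) * τ ^ (1 / 6 : ℝ)))
          = vdcA3hat * τ ^ (1 / 6 : ℝ) * ((2 ^ k * X) ^ (-σ) * (2 ^ k * X) ^ (1 / 2 : ℝ)) := by ring
        _ = vdcA3hat * (τ ^ (1 / 6 : ℝ) * X ^ (1 / 2 - σ)) * r ^ k := by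
            rw [← Real.rpow_add hXk0, neg_add_eq_sub, two_pow_mul_rpow k hX0]; ring
        _ = _ := by
            rw [hX, ← Real.rpow_mul hτ0.le, ← Real.rpow_add hτ0]
            congr 3
            ring)
  refine this.trans ?_
  rw [← mul_sum]
  have e : (2 : ℝ) ^ (σ - 1 / 2) = r⁻¹ := by
    rw [hr, ← Real.rpow_neg (by norm_num)]; congr 1; ring
  rw [e]
  have h1 : 0 < 1 - r := by linarith
  have e2 : vdcA3hat * r⁻¹ / (r⁻¹ - 1) * τ ^ (1 / 2 * (5 / 6 - σ)) =
      vdcA3hat * τ ^ (1 / 2 * (5 / 6 - σ)) * (1 / (1 - r)) := by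
    have : r⁻¹ - 1 = (1 - r) / r := by field_simp
    rw [this]
    field_simp
  rw [e2]
  exact mul_le_mul_of_nonneg_left (sum_geometric_le hr0.le hr1 K) (by positivity)

/-- The range `τ^{2/3} < n ≤ τ²`. -/
lemma norm_sum_Ioc_le_second {σ τ : ℝ} (hτ : 20 ≤ τ) (hσ : 0 < σ) (hσ1 : σ < 1) :
    ‖∑ n ∈ Ioc ⌊τ ^ (2 / 3 : ℝ)⌋₊ ⌊τ ^ (2 : ℝ)⌋₊,
        1 / (n : ℂ) ^ ((σ : ℂ) + ((2 * Real.pi * τ : ℝ) : ℂ) * Complex.I)‖ ≤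
      (2 : ℝ) ^ (1 + σ) * vdcA / (1 - (2 : ℝ) ^ (-σ)) * τ ^ (2 / 3 * (3 / 4 - σ))
        + 4 * vdcA * (1 + 4 * Real.log τ / (3 * Real.log 2)) * τ ^ (2 * (3 / 4 - σ)) := by
  have hτ0 : 0 < τ := by linarith
  have hA0 := vdcA_nonneg
  set X := τ ^ (2 / 3 : ℝ) with hX
  have hX0 : 0 < X := Real.rpow_pos_of_pos hτ0 _
  have hlog2 : 0 < Real.log 2 := Real.log_pos one_lt_two
  have hlogτ : 0 < Real.log τ := Real.log_pos (by linarith)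
  -- The base 2 logarithm of τ² / τ^{2/3}, rounded up; here K enters the final bound.
  set K := ⌈4 * Real.log τ / (3 * Real.log 2)⌉₊ with hK
  have hK1 : (K : ℝ) ≤ 1 + 4 * Real.log τ / (3 * Real.log 2) := by
    rw [add_comm]; exact (Nat.ceil_lt_add_one (by positivity)).le
  have hK2 : τ ^ (2 : ℝ) ≤ 2 ^ K * X := by
    rw [← Real.log_le_log_iff (by positivity) (by positivity), Real.log_mul (by positivity)
      (by positivity), Real.log_pow, hX, Real.log_rpow hτ0, Real.log_rpow hτ0]
    have := Nat.le_ceil (4 * Real.log τ / (3 * Real.log 2))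
    rw [← hK, div_le_iff₀ (by positivity)] at this
    linarith
  set r := (2 : ℝ) ^ (-σ) with hr
  have hr0 : 0 < r := Real.rpow_pos_of_pos (by norm_num) _
  have hr1 : r < 1 := Real.rpow_lt_one_of_one_lt_of_neg (by norm_num) (by linarith)
  have hsq : √τ = τ ^ (1 / 2 : ℝ) := Real.sqrt_eq_rpow τ
  have := norm_sum_Ioc_le_dyadic
    (fun n => 1 / (n : ℂ) ^ ((σ : ℂ) + ((2 * Real.pi * τ : ℝ) : ℂ) * Complex.I))
    (fun k => 2 * vdcA * τ ^ (2 / 3 * (3 / 4 - σ)) * r ^ k + 4 * vdcA * τ ^ (2 * (3 / 4 - σ)))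
    K hX0 hK2 (fun k => by positivity)
    (fun k _ M' _ hk hM' => by
      have hXk : X ≤ 2 ^ k * X := le_mul_of_one_le_left hX0.le (one_le_pow₀ (by norm_num))
      have hXk0 : 0 < 2 ^ k * X := by positivity
      have hτX : τ ≤ (2 ^ k * X) ^ 2 := by
        calc τ = τ ^ (1 : ℝ) := (Real.rpow_one τ).symm
          _ ≤ τ ^ (2 / 3 * (2 : ℕ) : ℝ) :=
              Real.rpow_le_rpow_of_exponent_le (by linarith) (by norm_num)
          _ = X ^ 2 := by rw [Real.rpow_mul hτ0.le, Real.rpow_natCast]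
          _ ≤ _ := by gcongr
      refine (norm_sum_Ioc_one_div_cpow_le hσ hXk0 hM' (fun N hN =>
        norm_zetaSum_le_second hτ0 hXk0 hτX (by
          exact_mod_cast (Nat.lt_floor_add_one (2 ^ k * X)).le) hN)).trans ?_
      calc (2 ^ k * X) ^ (-σ) * (2 * vdcA * (√τ + 2 * (2 ^ k * X) / √τ))
          = 2 * vdcA * (√τ * (2 ^ k * X) ^ (-σ)) +
            4 * vdcA * ((2 ^ k * X) ^ (-σ) * (2 ^ k * X) ^ (1 : ℝ) / √τ) := by
            rw [Real.rpow_one]; ring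
        _ = 2 * vdcA * (√τ * X ^ (-σ)) * r ^ k +
            4 * vdcA * ((2 ^ k * X) ^ (1 - σ) / √τ) := by
            rw [← Real.rpow_add hXk0, neg_add_eq_sub, two_pow_mul_rpow k hX0 (-σ)]; ring
        -- As σ < 1, the power 1 - σ increases with the block, so its base is replaced by τ².
        _ ≤ 2 * vdcA * (√τ * X ^ (-σ)) * r ^ k +
            4 * vdcA * ((τ ^ (2 : ℝ)) ^ (1 - σ) / √τ) := by
            gcongr
        _ = _ := by
            rw [hX, hsq, ← Real.rpow_mul hτ0.le, ← Real.rpow_mul hτ0.le, ← Real.rpow_add hτ0,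
              ← Real.rpow_sub hτ0]
            congr 4 <;> ring_nf)
  refine this.trans ?_
  rw [sum_add_distrib, ← mul_sum, sum_const, card_range, nsmul_eq_mul]
  refine add_le_add ?_ ?_
  -- The argument yields the factor 2; the stated 2^{1+σ} is weaker.
  · have h2 : (2 : ℝ) ≤ 2 ^ (1 + σ) := by
      calc (2 : ℝ) = 2 ^ (1 : ℝ) := (Real.rpow_one 2).symm
        _ ≤ _ := Real.rpow_le_rpow_of_exponent_le (by norm_num) (by linarith)
    have h3 : 0 < 1 - r := by linarith
    calc 2 * vdcA * τ ^ (2 / 3 * (3 / 4 - σ)) * ∑ k ∈ range K, r ^ k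
        ≤ 2 ^ (1 + σ) * vdcA * τ ^ (2 / 3 * (3 / 4 - σ)) * (1 / (1 - r)) := by
          gcongr
          exact sum_geometric_le hr0.le hr1 K
      _ = _ := by ring
  · calc (K : ℝ) * (4 * vdcA * τ ^ (2 * (3 / 4 - σ)))
        ≤ (1 + 4 * Real.log τ / (3 * Real.log 2)) * (4 * vdcA * τ ^ (2 * (3 / 4 - σ))) := by gcongr
      _ = _ := by ring

/-! ### The tail and the assembly. -/

/-- The tail `n > τ²`. -/
lemma norm_riemannZeta_sub_sum_sq_le {σ τ : ℝ} (hτ : 20 ≤ τ) (hσ : 1 / 2 < σ) (hσ1 : σ < 1) :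
    ‖riemannZeta ((σ : ℂ) + ((2 * Real.pi * τ : ℝ) : ℂ) * Complex.I) -
      ∑ n ∈ Icc 1 ⌊τ ^ (2 : ℝ)⌋₊,
        1 / (n : ℂ) ^ ((σ : ℂ) + ((2 * Real.pi * τ : ℝ) : ℂ) * Complex.I)‖ ≤
      8 * τ ^ (2 * (1 / 2 - σ)) := by
  have hτ0 : 0 < τ := by linarith
  have hpi := Real.pi_gt_three
  have hpi' := Real.pi_lt_d2
  have hsqr : τ ^ (2 : ℝ) = τ ^ 2 := by rw [← Real.rpow_natCast]; norm_num
  set N := ⌊τ ^ (2 : ℝ)⌋₊ with hN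
  have hN1 : (N : ℝ) ≤ τ ^ (2 : ℝ) := Nat.floor_le (by positivity)
  have hN2 : 0.9 * τ ^ (2 : ℝ) ≤ N := by
    have := (Nat.lt_floor_add_one (τ ^ (2 : ℝ))).le
    rw [← hN] at this
    rw [hsqr] at this ⊢
    nlinarith
  have hNpos : (0 : ℝ) < N := lt_of_lt_of_le (by positivity) hN2
  set s : ℂ := (σ : ℂ) + ((2 * Real.pi * τ : ℝ) : ℂ) * Complex.I with hs
  have hre : s.re = σ := by simp [hs]
  have him : s.im = 2 * Real.pi * τ := by simp [hs]
  have hs1 : s ≠ 1 := by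
    intro h; rw [h] at hre; simp at hre; linarith
  have key := norm_riemannZeta_sub_sum_le (N := N) (by exact_mod_cast hNpos) (s := s)
    (by rw [hre]; linarith) hs1
  rw [hre] at key
  refine key.trans ?_
  -- At N ≈ τ² the errors N^{1-σ}/|s - 1| and |s| N^{-σ} are both of order Q. The constants below
  -- add up to 1/6 + 7.2 < 8.
  set Q := τ ^ (2 * (1 / 2 - σ)) with hQ
  have hQ0 : 0 < Q := Real.rpow_pos_of_pos hτ0 _
  have hn1 : 6 * τ ≤ ‖s - 1‖ := by
    have := Complex.abs_im_le_norm (s - 1)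
    rw [Complex.sub_im, him, Complex.one_im, sub_zero, abs_of_pos (by positivity)] at this
    nlinarith
  have hn2 : ‖s‖ ≤ σ + 2 * Real.pi * τ := by
    rw [hs]
    refine (norm_add_le _ _).trans ?_
    rw [norm_mul, Complex.norm_I, mul_one, Complex.norm_real, Complex.norm_real,
      Real.norm_of_nonneg (by linarith), Real.norm_of_nonneg (by positivity)]
  have e1 : (τ ^ (2 : ℝ)) ^ (1 - σ) = Q * τ := by
    rw [hQ, ← Real.rpow_mul hτ0.le]
    nth_rw 3 [← Real.rpow_one τ]
    rw [← Real.rpow_add hτ0]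
    congr 1
    ring
  have e2 : (τ ^ (2 : ℝ)) ^ (-σ) = Q / τ := by
    rw [hQ, ← Real.rpow_mul hτ0.le]
    nth_rw 3 [← Real.rpow_one τ]
    rw [← Real.rpow_sub hτ0]
    congr 1
    ring
  have b1 : (N : ℝ) ^ (1 - σ) / ‖s - 1‖ ≤ Q / 6 := by
    calc (N : ℝ) ^ (1 - σ) / ‖s - 1‖ ≤ (τ ^ (2 : ℝ)) ^ (1 - σ) / (6 * τ) := by
          gcongr
      _ = Q / 6 := by rw [e1]; field_simp
  have b2 : (N : ℝ) ^ (-σ) ≤ Q / (0.9 * τ) := by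
    calc (N : ℝ) ^ (-σ) ≤ (0.9 * τ ^ (2 : ℝ)) ^ (-σ) :=
          Real.rpow_le_rpow_of_nonpos (by positivity) hN2 (by linarith)
      _ = 0.9 ^ (-σ) * (Q / τ) := by rw [Real.mul_rpow (by norm_num) (by positivity), e2]
      _ ≤ 0.9 ^ (-1 : ℝ) * (Q / τ) := by
          gcongr ?_ * _
          exact Real.rpow_le_rpow_of_exponent_ge (by norm_num) (by norm_num) (by linarith)
      _ = Q / (0.9 * τ) := by rw [Real.rpow_neg_one]; field_simp
  -- Uses 2σ > 1 to drop the denominator from the main part.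
  have b3 : ‖s‖ / (2 * σ) ≤ 1 / 2 + 2 * Real.pi * τ := by
    rw [div_le_iff₀ (by linarith)]
    have : 0 < 2 * Real.pi * τ := by positivity
    nlinarith
  have b4 : (1 + 2 * Real.pi * τ) * (Q / (0.9 * τ)) ≤ 7.2 * Q := by
    rw [mul_div_assoc', div_le_iff₀ (by positivity)]
    have : 1 + 2 * Real.pi * τ ≤ 6.48 * τ := by nlinarith
    nlinarith
  have b5 := mul_le_mul b3 b2 (by positivity) (by positivity)
  linarith

end

theorem mainTheorem7 (σ t τ : ℝ) (s : ℂ) (hs : s = (σ : ℂ) + (t : ℂ) * Complex.I)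
    (hτ : τ = t / (2 * Real.pi)) (hσ : 1 / 2 < σ) (hσ1 : σ < 1) (hτ20 : 20 ≤ τ) :
    ‖riemannZeta s - ∑ n ∈ Finset.Icc 1 ⌊τ ^ (1 / 2 : ℝ)⌋₊, 1 / (n : ℂ) ^ s‖ ≤
      vdcA3hat * (2 : ℝ) ^ (σ - 1 / 2) / ((2 : ℝ) ^ (σ - 1 / 2) - 1)
          * τ ^ (1 / 2 * (5 / 6 - σ))
        + (2 : ℝ) ^ (1 + σ) * vdcA / (1 - (2 : ℝ) ^ (-σ)) * τ ^ (2 / 3 * (3 / 4 - σ))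
        + 4 * vdcA * (1 + 4 * Real.log τ / (3 * Real.log 2)) * τ ^ (2 * (3 / 4 - σ))
        + 8 * τ ^ (2 * (1 / 2 - σ)) := by
  have ht : t = 2 * Real.pi * τ := by rw [hτ]; field_simp
  rw [ht] at hs
  have h1 := norm_sum_Ioc_le_third hτ20 hσ
  have h2 := norm_sum_Ioc_le_second hτ20 (by linarith) hσ1
  have h3 := norm_riemannZeta_sub_sum_sq_le hτ20 hσ hσ1
  rw [← hs] at h1 h2 h3
  have l1 : ⌊τ ^ (1 / 2 : ℝ)⌋₊ ≤ ⌊τ ^ (2 / 3 : ℝ)⌋₊ :=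
    Nat.floor_le_floor (Real.rpow_le_rpow_of_exponent_le (by linarith) (by norm_num))
  have l2 : ⌊τ ^ (2 / 3 : ℝ)⌋₊ ≤ ⌊τ ^ (2 : ℝ)⌋₊ :=
    Nat.floor_le_floor (Real.rpow_le_rpow_of_exponent_le (by linarith) (by norm_num))
  have e : ∀ N, Finset.Icc 1 N = Finset.Ioc 0 N := fun N => rfl
  rw [e] at h3 ⊢
  have e2 := Finset.sum_Ioc_consecutive (fun n : ℕ => 1 / (n : ℂ) ^ s) (Nat.zero_le _) (l1.trans l2)
  have e3 := Finset.sum_Ioc_consecutive (fun n : ℕ => 1 / (n : ℂ) ^ s) l1 l2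
  rw [← e2, ← e3] at h3
  set S0 := ∑ n ∈ Finset.Ioc 0 ⌊τ ^ (1 / 2 : ℝ)⌋₊, 1 / (n : ℂ) ^ s
  set S1 := ∑ n ∈ Finset.Ioc ⌊τ ^ (1 / 2 : ℝ)⌋₊ ⌊τ ^ (2 / 3 : ℝ)⌋₊, 1 / (n : ℂ) ^ s
  set S2 := ∑ n ∈ Finset.Ioc ⌊τ ^ (2 / 3 : ℝ)⌋₊ ⌊τ ^ (2 : ℝ)⌋₊, 1 / (n : ℂ) ^ s
  have e4 : riemannZeta s - S0 = (riemannZeta s - (S0 + (S1 + S2))) + S1 + S2 := by ring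
  rw [e4]
  have n1 := norm_add_le (riemannZeta s - (S0 + (S1 + S2)) + S1) S2
  have n2 := norm_add_le (riemannZeta s - (S0 + (S1 + S2))) S1
  linarith
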